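/- Let $I=[0,1]$ and let $f:I\to I$ be continuous. Let $\mathcal K(I)$ be the space of non-empty compact subsets of $I$ with the Hausdorff metric, and let $\overline f:\mathcal K(I)\to\mathcal K(I)$, $\overline f(K)=f(K)$, be the map induced by $f$. For a continuous self-map $g$ of a compact metric space $(X,d)$ and $\varepsilon>0$, call $g$ *generically chaotic* if the set of pairs $(x,y)\in X^2$ with $$\liminf_{n\to\infty} d(g^n(x),g^n(y))=0\quad\text{and}\quad \limsup_{n\to\infty} d(g^n(x),g^n(y))>0$$ is residual in $X^2$ (its complement is of first category), and *generically $\varepsilon$-chaotic* if the set of pairs $(x,y)\in X^2$ with $$\liminf_{n\to\infty} d(g^n(x),g^n(y))=0\quad\text{and}\quad \limsup_{n\to\infty} d(g^n(x),g^n(y))>\varepsilon$$ is residual in $X^2$. Then: 1. for every $\varepsilon>0$, if $f$ is generically $\varepsilon$-chaotic, then $\overline f$ is generically $\varepsilon$-chaotic (with the same $\varepsilon$); 2. if $f$ is generically chaotic, then $\overline f$ is generically chaotic; 3. if $\overline f$ is generically chaotic, then there is an $\varepsilon>0$ such that $\overline f$ is generically $\varepsilon$-chaotic. -/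

import Mathlib

open Filter TopologicalSpace

noncomputable section

/-- The pairs `(x, y)` with `liminf d(fⁿ x, fⁿ y) = 0`. Distances in a compact space are bounded,
so the real-valued `liminf` and `limsup` here and below are the genuine ones. -/
def proximalPairs {X : Type*} [MetricSpace X] [CompactSpace X] (f : C(X, X)) : Set (X × X) :=
  {p | liminf (fun n : ℕ => dist (f^[n] p.1) (f^[n] p.2)) atTop = 0}

/-- The pairs `(x, y)` with `limsup d(fⁿ x, fⁿ y) > ε`. -/
def separatedPairs {X : Type*} [MetricSpace X] [CompactSpace X] (f : C(X, X)) (ε : ℝ) :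
    Set (X × X) :=
  {p | limsup (fun n : ℕ => dist (f^[n] p.1) (f^[n] p.2)) atTop > ε}

/-- The set of Li-Yorke pairs of `f`. -/
def liYorkePairs {X : Type*} [MetricSpace X] [CompactSpace X] (f : C(X, X)) : Set (X × X) :=
  proximalPairs f ∩ separatedPairs f 0

/-- The set of `ε`-Li-Yorke pairs of `f`. -/
def epsLiYorkePairs {X : Type*} [MetricSpace X] [CompactSpace X] (f : C(X, X)) (ε : ℝ) :
    Set (X × X) :=
  proximalPairs f ∩ separatedPairs f ε

/-- `f` is generically chaotic: its Li-Yorke pairs are residual (comeagre) in `X × X`. -/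
def GenericallyChaotic {X : Type*} [MetricSpace X] [CompactSpace X] (f : C(X, X)) : Prop :=
  liYorkePairs f ∈ residual (X × X)

/-- `f` is generically `ε`-chaotic: its `ε`-Li-Yorke pairs are residual (comeagre) in `X × X`. -/
def GenericallyEpsChaotic {X : Type*} [MetricSpace X] [CompactSpace X] (f : C(X, X)) (ε : ℝ) :
    Prop :=
  epsLiYorkePairs f ε ∈ residual (X × X)

/-- The map `K ↦ f(K)` on the space of non-empty compact subsets of `X`, which carries the
Hausdorff metric. -/
def inducedMap {X : Type*} [MetricSpace X] (f : C(X, X)) :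
    C(NonemptyCompacts X, NonemptyCompacts X) where
  toFun := NonemptyCompacts.map f f.continuous
  continuous_toFun := f.continuous.nonemptyCompacts_map

end

/-!
Generic chaos of `f` or of the induced map makes any two nondegenerate intervals proximal and lets
every nondegenerate interval spread: its images have diameter above some `ε` infinitely often.

Suppose first that one `ε` serves all intervals. An interval longer than `ε` contains a member of a
fixed finite family of intervals, so some image of a given interval contains an interval covered by
one of its own images. For two such self-covering intervals, being close once implies being close
forever, so proximality improves to asymptoticity. Hence late images of finitely many intervals all
pass near a common point, and a compact set with one point in each can be chosen to shrink to it; on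
the other hand, a spreading interval moves one point away from suitable points of the others. By
Baire's theorem, these two facts say that the induced map is generically chaotic.

If no `ε` served all intervals, arbitrarily non-spreading ones would exist. Each contains an
eventually periodic point, and proximality to its own images confines it near a single point. These
points accumulate at a fixed point `x₀` that is stable on an invariant interval, and a dense open
part of this interval is attracted to `x₀` within any prescribed distance. There a generic pair of
points, or of compact sets, would converge to `x₀`, contradicting chaos.
-/

open Set Topology

/-- The distance of the endpoints decreases when passing to a smaller order interval: the link
between the metric and the order of `unitInterval`. -/
class HasMonotoneDist (α : Type*) [Preorder α] [Dist α] : Prop where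
  dist_le_dist {w x y z : α} : w ≤ x → x ≤ y → y ≤ z → dist x y ≤ dist w z

instance (s : Set ℝ) : HasMonotoneDist s where
  dist_le_dist {w x y z} hwx hxy hyz := by
    have hwx : (w : ℝ) ≤ x := hwx
    have hxy : (x : ℝ) ≤ y := hxy
    have hyz : (y : ℝ) ≤ z := hyz
    rw [Subtype.dist_eq, Subtype.dist_eq, dist_comm (x : ℝ), dist_comm (w : ℝ), Real.dist_eq,
      Real.dist_eq, abs_of_nonneg (by linarith), abs_of_nonneg (by linarith)]
    linarith

/-- A nondegenerate interval of a preorder: an order-connected set with at least two points. -/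
structure IsNondegInterval {α : Type*} [Preorder α] (J : Set α) : Prop where
  ordConnected : J.OrdConnected
  nontrivial : J.Nontrivial

section Intervals

variable {α : Type*} [ConditionallyCompleteLinearOrder α] [DenselyOrdered α] [TopologicalSpace α]
  [OrderTopology α] {g : α → α} {J U V W : Set α}

theorem isNondegInterval_Icc {α : Type*} [Preorder α] {x y : α} (h : x < y) :
    IsNondegInterval (Icc x y) :=
  ⟨ordConnected_Icc, x, left_mem_Icc.2 h.le, y, right_mem_Icc.2 h.le, h.ne⟩

theorem isNondegInterval_univ {α : Type*} [Preorder α] [Nontrivial α] :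
    IsNondegInterval (univ : Set α) :=
  ⟨ordConnected_univ, nontrivial_univ⟩

theorem ordConnected_image_of_continuous (hg : Continuous g) (hJ : J.OrdConnected) :
    (g '' J).OrdConnected :=
  (hJ.isPreconnected.image g hg.continuousOn).ordConnected

theorem IsNondegInterval.interior_nonempty (hJ : IsNondegInterval J) : (interior J).Nonempty := by
  obtain ⟨x, hx, y, hy, hxy⟩ := hJ.nontrivial.exists_lt
  exact (nonempty_Ioo.2 hxy).mono
    (interior_maximal (Ioo_subset_Icc_self.trans (hJ.ordConnected.out hx hy)) isOpen_Ioo)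

theorem IsNondegInterval.exists_subset_inter_nhds {z : α} (hJ : IsNondegInterval J) (hz : z ∈ J)
    (hV : V ∈ 𝓝 z) : ∃ K ⊆ J ∩ V, IsNondegInterval K := by
  obtain ⟨b, c, hzbc, hbc, hsub⟩ := exists_Icc_mem_subset_of_mem_nhds hV
  obtain ⟨y, ⟨hybc, hyJ⟩, hyz⟩ := accPt_iff_nhds.1
    (hJ.ordConnected.isPreconnected.preperfect_of_nontrivial hJ.nontrivial z hz) _ hbc
  exact ⟨J ∩ Icc b c, inter_subset_inter_right _ hsub, hJ.ordConnected.inter ordConnected_Icc,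
    y, ⟨hyJ, hybc⟩, z, ⟨hz, hzbc⟩, hyz⟩

theorem exists_isNondegInterval_subset [Nontrivial α] (hU : IsOpen U) (hne : U.Nonempty) :
    ∃ J ⊆ U, IsNondegInterval J := by
  obtain ⟨z, hz⟩ := hne
  simpa only [univ_inter] using
    isNondegInterval_univ.exists_subset_inter_nhds (mem_univ z) (hU.mem_nhds hz)

theorem IsNondegInterval.exists_image_subset (hJ : IsNondegInterval J) (hg : Continuous g)
    (hW : IsNondegInterval W) (hWJ : W ⊆ g '' J) : ∃ K ⊆ J, IsNondegInterval K ∧ g '' K ⊆ W := by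
  obtain ⟨w, hw⟩ := hW.interior_nonempty
  obtain ⟨z, hz, rfl⟩ := hWJ (interior_subset hw)
  obtain ⟨K, hKJ, hK⟩ := hJ.exists_subset_inter_nhds hz
    (hg.continuousAt.preimage_mem_nhds (mem_interior_iff_mem_nhds.1 hw))
  exact ⟨K, hKJ.trans inter_subset_left, hK, image_subset_iff.2 (hKJ.trans inter_subset_right)⟩

end Intervals

/-- The images of `J` under infinitely many iterates of `f` have diameter more than `ε`. -/
def SpreadsBeyond {X : Type*} [PseudoMetricSpace X] (f : X → X) (ε : ℝ) (J : Set X) : Prop :=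
  ∃ᶠ t in atTop, ε < Metric.diam (f^[t] '' J)

/-- The images of `J` and `K` under the iterates of `f` come arbitrarily close infinitely often:
the version for sets of the proximality of two points. -/
def ProximalSets {X : Type*} [PseudoMetricSpace X] (f : X → X) (J K : Set X) : Prop :=
  ∀ δ > 0, ∃ᶠ t in atTop, ∃ x ∈ J, ∃ y ∈ K, dist (f^[t] x) (f^[t] y) < δ

/-- The distance of the images of `J` and `K` under the iterates of `f` tends to zero: the version
for sets of the asymptoticity of two points. -/
def AsymptoticSets {X : Type*} [PseudoMetricSpace X] (f : X → X) (J K : Set X) : Prop :=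
  ∀ δ > 0, ∀ᶠ t in atTop, ∃ x ∈ J, ∃ y ∈ K, dist (f^[t] x) (f^[t] y) < δ

theorem image_iterate_add {X : Type*} (f : X → X) (m n : ℕ) (J : Set X) :
    f^[m + n] '' J = f^[m] '' (f^[n] '' J) := by
  rw [Function.iterate_add, image_comp]

theorem subset_image_iterate_mul {X : Type*} {f : X → X} {n : ℕ} {Q : Set X} (h : Q ⊆ f^[n] '' Q)
    (j : ℕ) : Q ⊆ f^[n * j] '' Q := by
  induction j with
  | zero => simp only [mul_zero, Function.iterate_zero, image_id, subset_rfl]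
  | succ j ih =>
    rw [Nat.mul_succ, add_comm, image_iterate_add]
    exact h.trans (image_mono ih)

section Spreading

variable {X : Type*} [PseudoMetricSpace X] {f : X → X} {ε ε' : ℝ} {J K J' K' : Set X}

theorem exists_lt_dist_of_lt_diam (hε : 0 ≤ ε) (h : ε < Metric.diam J) :
    ∃ x ∈ J, ∃ y ∈ J, ε < dist x y := by
  by_contra! hJ
  exact h.not_ge (Metric.diam_le_of_forall_dist_le hε hJ)

theorem SpreadsBeyond.mono [CompactSpace X] (h : SpreadsBeyond f ε J) (hε : ε' ≤ ε)
    (hJK : J ⊆ K) : SpreadsBeyond f ε' K :=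
  Frequently.mono h fun _ ht =>
    hε.trans_lt (ht.trans_le (Metric.diam_mono (image_mono hJK) (Bornology.IsBounded.all _)))

theorem SpreadsBeyond.of_image_iterate {t : ℕ} (h : SpreadsBeyond f ε (f^[t] '' J)) :
    SpreadsBeyond f ε J := by
  simp only [SpreadsBeyond, ← image_iterate_add] at h
  exact (tendsto_add_atTop_nat t).frequently h

theorem SpreadsBeyond.nontrivial_image_iterate (h : SpreadsBeyond f ε J) (hε : 0 ≤ ε) (t : ℕ) :
    (f^[t] '' J).Nontrivial := by
  rw [← not_subsingleton_iff]
  intro hsub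
  obtain ⟨s, hts, hs⟩ := frequently_atTop.1 h t
  rw [← Nat.sub_add_cancel hts, image_iterate_add, Metric.diam_subsingleton (hsub.image _)] at hs
  exact hε.not_gt hs

theorem ProximalSets.mono (h : ProximalSets f J K) (hJ : J ⊆ J') (hK : K ⊆ K') :
    ProximalSets f J' K' := fun δ hδ =>
  (h δ hδ).mono fun _ ⟨x, hx, y, hy, hxy⟩ => ⟨x, hJ hx, y, hK hy, hxy⟩

theorem AsymptoticSets.mono (h : AsymptoticSets f J K) (hJ : J ⊆ J') (hK : K ⊆ K') :
    AsymptoticSets f J' K' := fun δ hδ =>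
  (h δ hδ).mono fun _ ⟨x, hx, y, hy, hxy⟩ => ⟨x, hJ hx, y, hK hy, hxy⟩

theorem AsymptoticSets.of_image_iterate {t : ℕ}
    (h : AsymptoticSets f (f^[t] '' J) (f^[t] '' K)) : AsymptoticSets f J K := by
  simp only [AsymptoticSets, exists_mem_image, ← Function.iterate_add_apply] at h
  intro δ hδ
  rw [← map_add_atTop_eq_nat t]
  exact h δ hδ

/-- By uniform continuity, sets that come close stay close for any prescribed length of time. -/
theorem ProximalSets.frequently_forall_le_dist_lt [CompactSpace X] (h : ProximalSets f J K)
    (hf : Continuous f) (M : ℕ) {δ : ℝ} (hδ : 0 < δ) :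
    ∃ᶠ t in atTop, ∃ x ∈ J, ∃ y ∈ K, ∀ i ≤ M, dist (f^[i] (f^[t] x)) (f^[i] (f^[t] y)) < δ := by
  have hclose : ∀ᶠ p in uniformity X, ∀ i ∈ Iic M, dist (f^[i] p.1) (f^[i] p.2) < δ :=
    (eventually_all_finite (finite_Iic M)).2 fun i _ =>
      CompactSpace.uniformContinuous_of_continuous (hf.iterate i) (Metric.dist_mem_uniformity hδ)
  obtain ⟨η, hη, hηδ⟩ := Metric.mem_uniformity_dist.1 hclose
  exact (h η hη).mono fun t ⟨x, hx, y, hy, hxy⟩ => ⟨x, hx, y, hy, fun i hi => hηδ hxy i hi⟩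

theorem ProximalSets.asymptoticSets_of_subset_image_iterate [CompactSpace X]
    (h : ProximalSets f J K) (hf : Continuous f) {M : ℕ} (hM : 0 < M) (hJ : J ⊆ f^[M] '' J)
    (hK : K ⊆ f^[M] '' K) : AsymptoticSets f J K := by
  intro δ hδ
  obtain ⟨t₀, x, hx, y, hy, hxy⟩ := (h.frequently_forall_le_dist_lt hf M hδ).exists
  filter_upwards [eventually_ge_atTop t₀] with t ht
  obtain ⟨x', hx', rfl⟩ := subset_image_iterate_mul hJ ((t - t₀) / M) hx
  obtain ⟨y', hy', rfl⟩ := subset_image_iterate_mul hK ((t - t₀) / M) hy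
  have hlt := hxy ((t - t₀) % M) (Nat.mod_lt _ hM).le
  simp only [← Function.iterate_add_apply] at hlt
  have htime : (t - t₀) % M + t₀ + M * ((t - t₀) / M) = t := by
    have := Nat.mod_add_div (t - t₀) M
    omega
  rw [← add_assoc, htime] at hlt
  exact ⟨x', hx', y', hy', hlt⟩

end Spreading

theorem exists_rel_self_of_finite {β : Type*} {r : β → β → Prop} [IsTrans β r] {s : Set β}
    (hs : s.Finite) (hne : s.Nonempty) (h : ∀ a ∈ s, ∃ b ∈ s, r a b) : ∃ a ∈ s, r a a := by
  by_contra! hirr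
  have : Finite s := hs
  have : IsTrans s (fun a b => r b a) := ⟨fun a b c hab hbc => _root_.trans hbc hab⟩
  have : Std.Irrefl fun a b : s => r b a := ⟨fun a => hirr a a.2⟩
  obtain ⟨m, -, hm⟩ := (Finite.wellFounded_of_trans_of_irrefl fun a b : s => r b a).has_min univ
    ⟨⟨_, hne.some_mem⟩, mem_univ _⟩
  obtain ⟨b, hb, hab⟩ := h m m.2
  exact hm ⟨b, hb⟩ (mem_univ _) hab

section SpreadingIntervals

variable {α : Type*} [ConditionallyCompleteLinearOrder α] [DenselyOrdered α] [MetricSpace α]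
  [OrderTopology α] {f : α → α} {ε : ℝ} {J K : Set α}

theorem IsNondegInterval.image_iterate (hJ : IsNondegInterval J) (hf : Continuous f)
    (h : SpreadsBeyond f ε J) (hε : 0 ≤ ε) (t : ℕ) : IsNondegInterval (f^[t] '' J) :=
  ⟨ordConnected_image_of_continuous (hf.iterate t) hJ.ordConnected,
    h.nontrivial_image_iterate hε t⟩

variable [CompactSpace α]

variable (α) in
theorem exists_finite_isNondegInterval_subset (hε : 0 < ε) :
    ∃ F : Set (Set α), F.Finite ∧ (∀ L ∈ F, IsNondegInterval L) ∧
      ∀ J : Set α, J.OrdConnected → ε < Metric.diam J → ∃ L ∈ F, L ⊆ J := by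
  have hcompact : IsCompact {z : α × α | z.1 ≤ z.2 ∧ ε ≤ dist z.1 z.2} :=
    ((isClosed_le continuous_fst continuous_snd).inter
      (isClosed_le continuous_const continuous_dist)).isCompact
  obtain ⟨F, hF, hFI, hFsub⟩ : ∃ F : Set (Set α), F.Finite ∧ (∀ L ∈ F, IsNondegInterval L) ∧
      ∀ z ∈ {z : α × α | z.1 ≤ z.2 ∧ ε ≤ dist z.1 z.2}, ∃ L ∈ F, L ⊆ Icc z.1 z.2 := by
    refine hcompact.induction_on ⟨∅, finite_empty, by simp, by simp⟩
      (fun s t hst ⟨F, hF, hFI, h⟩ => ⟨F, hF, hFI, fun z hz => h z (hst hz)⟩) ?_ ?_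
    · rintro s t ⟨F, hF, hFI, h⟩ ⟨F', hF', hFI', h'⟩
      refine ⟨F ∪ F', hF.union hF', fun L hL => hL.elim (hFI L) (hFI' L), ?_⟩
      rintro z (hz | hz)
      · exact (h z hz).imp fun L hL => ⟨.inl hL.1, hL.2⟩
      · exact (h' z hz).imp fun L hL => ⟨.inr hL.1, hL.2⟩
    · rintro ⟨a, b⟩ ⟨hab : a ≤ b, hε' : ε ≤ dist a b⟩
      obtain ⟨p, hap, hpb⟩ := exists_between (hab.lt_of_ne (dist_pos.1 (hε.trans_le hε')))
      obtain ⟨q, hpq, hqb⟩ := exists_between hpb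
      refine ⟨Iio p ×ˢ Ioi q, mem_nhdsWithin_of_mem_nhds (prod_mem_nhds (Iio_mem_nhds hap)
        (Ioi_mem_nhds hqb)), {Icc p q}, finite_singleton _, ?_, ?_⟩
      · rintro L rfl
        exact isNondegInterval_Icc hpq
      · rintro z ⟨hz1, hz2⟩
        exact ⟨_, rfl, Icc_subset_Icc (le_of_lt hz1) (le_of_lt hz2)⟩
  refine ⟨F, hF, hFI, fun J hJ hdiam => ?_⟩
  obtain ⟨x, hx, y, hy, hxy⟩ := exists_lt_dist_of_lt_diam hε.le hdiam
  rcases le_total x y with hle | hle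
  · exact (hFsub (x, y) ⟨hle, hxy.le⟩).imp fun L hL => ⟨hL.1, hL.2.trans (hJ.out hx hy)⟩
  · exact (hFsub (y, x) ⟨hle, (dist_comm x y ▸ hxy).le⟩).imp
      fun L hL => ⟨hL.1, hL.2.trans (hJ.out hy hx)⟩

theorem exists_uniform_spreadsBeyond (hf : Continuous f) (hε : 0 < ε)
    (h : ∀ J, IsNondegInterval J → ∃ ε' > ε, SpreadsBeyond f ε' J) :
    ∃ ε' > ε, ∀ J, IsNondegInterval J → SpreadsBeyond f ε' J := by
  obtain ⟨F, hF, hFI, hFsub⟩ := exists_finite_isNondegInterval_subset α hε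
  have hev : ∀ L ∈ F, ∀ᶠ e in 𝓝[>] ε, SpreadsBeyond f e L := fun L hL => by
    obtain ⟨ε', hε', hL⟩ := h L (hFI L hL)
    filter_upwards [Ioo_mem_nhdsGT hε'] with e he using hL.mono he.2.le subset_rfl
  obtain ⟨e, he, heε⟩ := (((eventually_all_finite hF).2 hev).and self_mem_nhdsWithin).exists
  refine ⟨e, heε, fun J hJ => ?_⟩
  obtain ⟨ε', hε', hspread⟩ := h J hJ
  obtain ⟨t, ht⟩ := hspread.exists
  obtain ⟨L, hL, hLJ⟩ := hFsub _
    (ordConnected_image_of_continuous (hf.iterate t) hJ.ordConnected) (hε'.lt.trans ht)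
  exact ((he L hL).mono le_rfl hLJ).of_image_iterate

/-- Some image of `J` contains an interval of the finite family of
`exists_finite_isNondegInterval_subset`, hence so does some image of that interval, and so on;
by finiteness this ends in a cycle. -/
theorem exists_subset_image_iterate_self (hf : Continuous f) (hε : 0 < ε)
    (hspread : ∀ J, IsNondegInterval J → SpreadsBeyond f ε J) (hJ : IsNondegInterval J) :
    ∃ t, ∃ n > 0, ∃ Q, IsNondegInterval Q ∧ Q ⊆ f^[t] '' J ∧ Q ⊆ f^[n] '' Q := by
  obtain ⟨F, hF, hFI, hFsub⟩ := exists_finite_isNondegInterval_subset α hε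
  let covers : Set α → Set α → Prop := fun P Q => ∃ t > 0, Q ⊆ f^[t] '' P
  have hcovers : ∀ P, IsNondegInterval P → ∃ Q ∈ F, covers P Q := fun P hP => by
    obtain ⟨t, ht, hdiam⟩ := frequently_atTop.1 (hspread P hP) 1
    obtain ⟨Q, hQ, hQP⟩ :=
      hFsub _ (ordConnected_image_of_continuous (hf.iterate t) hP.ordConnected) hdiam
    exact ⟨Q, hQ, t, ht, hQP⟩
  have : IsTrans (Set α) covers := ⟨fun P Q R ⟨s, hs, hPQ⟩ ⟨t, _, hQR⟩ =>
    ⟨t + s, by omega, hQR.trans (image_iterate_add f t s P ▸ image_mono hPQ)⟩⟩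
  obtain ⟨Q, ⟨hQ, t, -, hJQ⟩, n, hn, hQQ⟩ :=
    exists_rel_self_of_finite (r := covers) (hF.subset (sep_subset F (covers J))) (hcovers J hJ)
      fun P hP => (hcovers P (hFI P hP.1)).imp fun Q hQ => ⟨⟨hQ.1, _root_.trans hP.2 hQ.2⟩, hQ.2⟩
  exact ⟨t, n, hn, Q, hFI Q hQ, hJQ, hQQ⟩

theorem asymptoticSets_of_spreadsBeyond_of_proximalSets (hf : Continuous f) (hε : 0 < ε)
    (hspread : ∀ J, IsNondegInterval J → SpreadsBeyond f ε J)
    (hprox : ∀ J K, IsNondegInterval J → IsNondegInterval K → ProximalSets f J K)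
    (hJ : IsNondegInterval J) (hK : IsNondegInterval K) : AsymptoticSets f J K := by
  obtain ⟨s, m, hm, P, hP, hPJ, hPP⟩ := exists_subset_image_iterate_self hf hε hspread hJ
  obtain ⟨t, n, hn, Q, hQ, hQK, hQQ⟩ := exists_subset_image_iterate_self hf hε hspread hK
  have hPP' : f^[t] '' P ⊆ f^[m * n] '' (f^[t] '' P) := by
    rw [← image_iterate_add, add_comm, image_iterate_add]
    exact image_mono (subset_image_iterate_mul hPP n)
  have hQQ' : f^[s] '' Q ⊆ f^[m * n] '' (f^[s] '' Q) := by
    rw [← image_iterate_add, add_comm, image_iterate_add, mul_comm]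
    exact image_mono (subset_image_iterate_mul hQQ m)
  have hasymp : AsymptoticSets f (f^[t] '' P) (f^[s] '' Q) :=
    (hprox _ _ (hP.image_iterate hf (hspread P hP) hε.le t)
      (hQ.image_iterate hf (hspread Q hQ) hε.le s)).asymptoticSets_of_subset_image_iterate hf
      (Nat.mul_pos hm hn) hPP' hQQ'
  refine AsymptoticSets.of_image_iterate (t := s + t) (hasymp.mono ?_ ?_)
  · rw [add_comm, image_iterate_add]
    exact image_mono hPJ
  · rw [image_iterate_add]
    exact image_mono hQK

end SpreadingIntervals

section IntervalConfigurations

variable {α ι : Type*} [LinearOrder α] {ε : ℝ} {F : Finset ι} {A : ι → Set α} {U : Set α} {x y : α}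

theorem subset_Iic_or_subset_Ici_of_inter_subsingleton {B : Set α} (hU : U.OrdConnected)
    (hB : IsNondegInterval B) (hUB : (U ∩ B).Subsingleton) (hx : x ∈ U) (hy : y ∈ U)
    (hxy : x < y) : B ⊆ Iic x ∨ B ⊆ Ici y := by
  have hIoo : ∀ m ∈ B, x < m → y ≤ m := by
    by_contra! ⟨m, hmB, hxm, hmy⟩
    have hmU : m ∈ U := hU.out hx hy ⟨hxm.le, hmy.le⟩
    obtain ⟨a, haB, ham⟩ := hB.nontrivial.exists_ne m
    rcases ham.lt_or_gt with h | h
    · exact (max_lt h hxm).ne (hUB ⟨hU.out hx hmU ⟨le_max_right a x, (max_lt h hxm).le⟩,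
        hB.ordConnected.out haB hmB ⟨le_max_left a x, (max_lt h hxm).le⟩⟩ ⟨hmU, hmB⟩)
    · exact (lt_min h hmy).ne (hUB ⟨hmU, hmB⟩ ⟨hU.out hmU hy ⟨(lt_min h hmy).le, min_le_right a y⟩,
        hB.ordConnected.out hmB haB ⟨(lt_min h hmy).le, min_le_left a y⟩⟩)
  by_contra! h
  obtain ⟨a, haB, hxa⟩ := not_subset.1 h.1
  obtain ⟨b, hbB, hby⟩ := not_subset.1 h.2
  have hya : y ≤ a := hIoo a haB (not_le.1 hxa)
  have hbx : b ≤ x := not_lt.1 fun hlt => hby (hIoo b hbB hlt)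
  exact hxy.ne (hUB ⟨hx, hB.ordConnected.out hbB haB ⟨hbx, hxy.le.trans hya⟩⟩
    ⟨hy, hB.ordConnected.out hbB haB ⟨hbx.trans hxy.le, hya⟩⟩)

variable [PseudoMetricSpace α] [HasMonotoneDist α]

/-- A Helly property: the point is the rightmost of the left ends. -/
theorem exists_forall_exists_dist_lt (hF : F.Nonempty) (hA : ∀ i ∈ F, (A i).OrdConnected)
    (h : ∀ i ∈ F, ∀ j ∈ F, ∃ x ∈ A i, ∃ y ∈ A j, dist x y < ε) :
    ∃ p, ∀ i ∈ F, ∃ x ∈ A i, dist x p < ε := by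
  have : Nonempty α := hF.elim fun i hi => (h i hi i hi).nonempty
  choose! u hu v hv huv using h
  have hmin : ∀ i ∈ F, ∃ m ∈ A i, ∀ j ∈ F, m ≤ v j i := fun i hi => by
    obtain ⟨j, hj, hle⟩ := F.exists_min_image (fun j => v j i) hF
    exact ⟨v j i, hv j hj i hi, hle⟩
  choose! m hm hmv using hmin
  obtain ⟨k, hk, hmax⟩ := F.exists_max_image m hF
  refine ⟨m k, fun i hi => ?_⟩
  rcases le_total (m k) (u i k) with hle | hle
  · refine ⟨m k, (hA i hi).out (hm i hi) (hu i hi k hk) ⟨hmax i hi, hle⟩, ?_⟩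
    rw [dist_self]
    exact dist_nonneg.trans_lt (huv i hi k hk)
  · exact ⟨u i k, hu i hi k hk,
      (HasMonotoneDist.dist_le_dist le_rfl hle (hmv k hk i hi)).trans_lt (huv i hi k hk)⟩

theorem exists_mem_forall_exists_lt_dist (hU : U.OrdConnected) (hx : x ∈ U) (hy : y ∈ U)
    (hxy : x < y) (hε : ε < dist x y) (hA : ∀ i ∈ F, IsNondegInterval (A i))
    (hUA : ∀ i ∈ F, U ⊆ A i ∨ (U ∩ A i).Subsingleton)
    (h : ∀ i ∈ F, ∀ j ∈ F, ∃ a ∈ A i, ∃ b ∈ A j, dist a b < ε) :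
    ∃ z ∈ U, ∀ i ∈ F, ∃ w ∈ A i, ε < dist z w := by
  have hcases : ∀ i ∈ F, U ⊆ A i ∨ A i ⊆ Iic x ∨ A i ⊆ Ici y := fun i hi =>
    (hUA i hi).imp_right fun hsub =>
      subset_Iic_or_subset_Ici_of_inter_subsingleton hU (hA i hi) hsub hx hy hxy
  by_cases hright : ∃ k ∈ F, A k ⊆ Ici y
  · obtain ⟨k, hk, hky⟩ := hright
    refine ⟨x, hx, fun i hi => ?_⟩
    rcases hcases i hi with hUi | hi' | hi'
    · exact ⟨y, hUi hy, hε⟩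
    · obtain ⟨a, ha, b, hb, hab⟩ := h i hi k hk
      exact absurd hab (hε.le.trans
        (HasMonotoneDist.dist_le_dist (hi' ha) hxy.le (hky hb))).not_gt
    · obtain ⟨w, hw⟩ := (hA i hi).nontrivial.nonempty
      exact ⟨w, hw, hε.trans_le (HasMonotoneDist.dist_le_dist le_rfl hxy.le (hi' hw))⟩
  · refine ⟨y, hy, fun i hi => ?_⟩
    rcases hcases i hi with hUi | hi' | hi'
    · exact ⟨x, hUi hx, dist_comm x y ▸ hε⟩
    · obtain ⟨w, hw⟩ := (hA i hi).nontrivial.nonempty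
      refine ⟨w, hw, ?_⟩
      rw [dist_comm y w]
      exact hε.trans_le (HasMonotoneDist.dist_le_dist (hi' hw) hxy.le le_rfl)
    · exact absurd ⟨i, hi, hi'⟩ hright

end IntervalConfigurations

theorem eventually_forall_exists_dist_lt_of_asymptoticSets
    {α ι : Type*} [Preorder α] [PseudoMetricSpace α] {f : α → α} {ε : ℝ} {F : Finset ι}
    {A : ι → Set α}
    (hasymp : ∀ J K, IsNondegInterval J → IsNondegInterval K → AsymptoticSets f J K)
    (hA : ∀ i ∈ F, IsNondegInterval (A i)) (hε : 0 < ε) :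
    ∀ᶠ t in atTop, ∀ i ∈ F, ∀ j ∈ F, ∃ x ∈ f^[t] '' A i, ∃ y ∈ f^[t] '' A j, dist x y < ε := by
  simp only [exists_mem_image]
  exact (eventually_all_finset F).2 fun i hi => (eventually_all_finset F).2 fun j hj =>
    hasymp _ _ (hA i hi) (hA j hj) ε hε

section IntervalFamilies

variable {α ι : Type*} [ConditionallyCompleteLinearOrder α] [DenselyOrdered α]

theorem exists_subset_image_iterate_subset_or_subsingleton [TopologicalSpace α] [OrderTopology α]
    {f : α → α} (hf : Continuous f) {U : Set α} (hU : IsNondegInterval U) (F : Finset ι)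
    {A : ι → Set α} (hA : ∀ i ∈ F, (A i).OrdConnected) :
    ∃ V ⊆ U, IsNondegInterval V ∧ ∀ i ∈ F, (∃ t, f^[t] '' V ⊆ f^[t] '' A i) ∨
      ∀ t, (f^[t] '' V ∩ f^[t] '' A i).Subsingleton := by
  classical
  induction F using Finset.induction_on with
  | empty => exact ⟨U, subset_rfl, hU, by simp⟩
  | insert k F _ ih =>
    rw [Finset.forall_mem_insert] at hA
    obtain ⟨V, hVU, hV, hVF⟩ := ih hA.2
    simp only [Finset.forall_mem_insert]
    by_cases hk : ∀ t, (f^[t] '' V ∩ f^[t] '' A k).Subsingleton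
    · exact ⟨V, hVU, hV, .inr hk, hVF⟩
    push Not at hk
    obtain ⟨t, ht⟩ := hk
    obtain ⟨V', hV'V, hV', hsub⟩ := hV.exists_image_subset (hf.iterate t)
      ⟨(ordConnected_image_of_continuous (hf.iterate t) hV.ordConnected).inter
        (ordConnected_image_of_continuous (hf.iterate t) hA.1), ht⟩ inter_subset_left
    refine ⟨V', hV'V.trans hVU, hV', .inl ⟨t, hsub.trans inter_subset_right⟩, fun i hi => ?_⟩
    exact (hVF i hi).imp (fun ⟨s, hs⟩ => ⟨s, (image_mono hV'V).trans hs⟩)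
      fun hs t => (hs t).anti (inter_subset_inter_left _ (image_mono hV'V))

variable [MetricSpace α] [OrderTopology α] [HasMonotoneDist α] {f : α → α} {ε : ℝ} {F : Finset ι}
  {A : ι → Set α}

theorem frequently_exists_forall_exists_lt_dist (hf : Continuous f) (hε : 0 < ε)
    (hspread : ∀ J, IsNondegInterval J → SpreadsBeyond f ε J)
    (hasymp : ∀ J K, IsNondegInterval J → IsNondegInterval K → AsymptoticSets f J K)
    {U : Set α} (hU : IsNondegInterval U) (hA : ∀ i ∈ F, IsNondegInterval (A i)) :
    ∃ᶠ t in atTop, ∃ z ∈ f^[t] '' U, ∀ i ∈ F, ∃ w ∈ f^[t] '' A i, ε < dist z w := by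
  obtain ⟨V, hVU, hV, hVA⟩ := exists_subset_image_iterate_subset_or_subsingleton hf hU F
    fun i hi => (hA i hi).ordConnected
  have hev : ∀ᶠ t in atTop, ∀ i ∈ F, f^[t] '' V ⊆ f^[t] '' A i ∨
      (f^[t] '' V ∩ f^[t] '' A i).Subsingleton := by
    refine (eventually_all_finset F).2 fun i hi => ?_
    rcases hVA i hi with ⟨s, hs⟩ | hs
    · filter_upwards [eventually_ge_atTop s] with t ht
      rw [← Nat.sub_add_cancel ht, image_iterate_add, image_iterate_add]
      exact .inl (image_mono hs)
    · exact .of_forall fun t => .inr (hs t)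
  refine ((hspread V hV).and_eventually
    (hev.and (eventually_forall_exists_dist_lt_of_asymptoticSets hasymp hA hε))).mono ?_
  rintro t ⟨hdiam, hsub, hclose⟩
  obtain ⟨x, hx, y, hy, hxy, hε'⟩ : ∃ x ∈ f^[t] '' V, ∃ y ∈ f^[t] '' V, x < y ∧ ε < dist x y := by
    obtain ⟨x, hx, y, hy, hlt⟩ := exists_lt_dist_of_lt_diam hε.le hdiam
    rcases (dist_pos.1 (hε.trans hlt)).lt_or_gt with h | h
    exacts [⟨x, hx, y, hy, h, hlt⟩, ⟨y, hy, x, hx, h, dist_comm x y ▸ hlt⟩]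
  obtain ⟨z, hz, hzw⟩ := exists_mem_forall_exists_lt_dist
    (ordConnected_image_of_continuous (hf.iterate t) hV.ordConnected) hx hy hxy hε'
    (fun i hi => (hA i hi).image_iterate hf (hspread _ (hA i hi)) hε.le t) hsub hclose
  exact ⟨z, image_mono hVU hz, hzw⟩

end IntervalFamilies

section LiYorkePairs

variable {X : Type*} [MetricSpace X] {f : C(X, X)} {ε : ℝ} {p : X × X}

theorem isBoundedUnder_ge_dist_iterate :
    IsBoundedUnder (· ≥ ·) atTop fun n : ℕ => dist (f^[n] p.1) (f^[n] p.2) :=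
  isBoundedUnder_of ⟨0, fun _ => dist_nonneg⟩

variable [CompactSpace X]

theorem isBoundedUnder_le_dist_iterate :
    IsBoundedUnder (· ≤ ·) atTop fun n : ℕ => dist (f^[n] p.1) (f^[n] p.2) :=
  isBoundedUnder_of ⟨Metric.diam (univ : Set X), fun _ =>
    Metric.dist_le_diam_of_mem (Bornology.IsBounded.all _) (mem_univ _) (mem_univ _)⟩

theorem mem_proximalPairs_iff : p ∈ proximalPairs f ↔
    ∀ δ > 0, ∃ᶠ n in atTop, dist (f^[n] p.1) (f^[n] p.2) < δ := by
  refine ⟨fun hp δ hδ => frequently_lt_of_liminf_lt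
    isBoundedUnder_le_dist_iterate.isCoboundedUnder_ge (lt_of_eq_of_lt hp hδ), fun h => ?_⟩
  refine le_antisymm (le_of_forall_pos_le_add fun δ hδ => ?_) ?_
  · rw [zero_add]
    exact liminf_le_of_frequently_le ((h δ hδ).mono fun _ => le_of_lt)
      isBoundedUnder_ge_dist_iterate
  · exact le_liminf_of_le isBoundedUnder_le_dist_iterate.isCoboundedUnder_ge
      (.of_forall fun _ => dist_nonneg)

theorem mem_separatedPairs_iff : p ∈ separatedPairs f ε ↔
    ∃ ε' > ε, ∃ᶠ n in atTop, ε' < dist (f^[n] p.1) (f^[n] p.2) := by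
  constructor
  · intro h
    obtain ⟨ε', hε', hlt⟩ := exists_between (show ε < _ from h)
    exact ⟨ε', hε', frequently_lt_of_lt_limsup
      isBoundedUnder_ge_dist_iterate.isCoboundedUnder_le hlt⟩
  · rintro ⟨ε', hε', h⟩
    exact hε'.lt.trans_le (le_limsup_of_frequently_le (h.mono fun _ => le_of_lt)
      isBoundedUnder_le_dist_iterate)

theorem GenericallyEpsChaotic.genericallyChaotic (h : GenericallyEpsChaotic f ε) (hε : 0 ≤ ε) :
    GenericallyChaotic f :=
  mem_of_superset h (inter_subset_inter_right _ fun _ hp => hε.trans_lt hp)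

theorem frequently_mem_residual {Y : Type*} [TopologicalSpace Y] {P : ℕ → Set Y}
    (hP : ∀ t, IsOpen (P t))
    (h : ∀ V : Set Y, IsOpen V → V.Nonempty → ∃ᶠ t in atTop, (V ∩ P t).Nonempty) :
    {y | ∃ᶠ t in atTop, y ∈ P t} ∈ residual Y := by
  have hres : ∀ N, ⋃ t ≥ N, P t ∈ residual Y := fun N => by
    refine residual_of_dense_open (isOpen_biUnion fun t _ => hP t)
      (dense_iff_inter_open.2 fun V hV hne => ?_)
    obtain ⟨t, ht, y, hyV, hy⟩ := frequently_atTop.1 (h V hV hne) N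
    exact ⟨y, hyV, mem_biUnion ht hy⟩
  filter_upwards [countable_iInter_mem.2 hres] with y hy
  exact frequently_atTop.2 fun N => by simpa using mem_iInter.1 hy N

theorem genericallyEpsChaotic_of_forall_isOpen {ε' : ℝ} (hε' : ε < ε')
    (hprox : ∀ δ > 0, ∀ V : Set (X × X), IsOpen V → V.Nonempty →
      ∃ᶠ t in atTop, ∃ p ∈ V, dist (f^[t] p.1) (f^[t] p.2) < δ)
    (hsep : ∀ V : Set (X × X), IsOpen V → V.Nonempty →
      ∃ᶠ t in atTop, ∃ p ∈ V, ε' < dist (f^[t] p.1) (f^[t] p.2)) :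
    GenericallyEpsChaotic f ε := by
  have hcont : ∀ t, Continuous fun p : X × X => dist (f^[t] p.1) (f^[t] p.2) := fun t =>
    ((f.continuous.iterate t).comp continuous_fst).dist
      ((f.continuous.iterate t).comp continuous_snd)
  have hproxres : ∀ n : ℕ, {p : X × X | ∃ᶠ t in atTop,
      p ∈ {q | dist (f^[t] q.1) (f^[t] q.2) < 1 / ((n : ℝ) + 1)}} ∈ residual (X × X) := fun n =>
    frequently_mem_residual (fun t => isOpen_lt (hcont t) continuous_const)
      (hprox _ Nat.one_div_pos_of_nat)
  have hsepres : {p : X × X | ∃ᶠ t in atTop, p ∈ {q | ε' < dist (f^[t] q.1) (f^[t] q.2)}} ∈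
      residual (X × X) :=
    frequently_mem_residual (fun t => isOpen_lt continuous_const (hcont t)) hsep
  filter_upwards [countable_iInter_mem.2 hproxres, hsepres] with p hp hps
  refine ⟨mem_proximalPairs_iff.2 fun δ hδ => ?_, mem_separatedPairs_iff.2 ⟨ε', hε', hps⟩⟩
  obtain ⟨n, hn⟩ := exists_nat_one_div_lt hδ
  exact Frequently.mono (mem_iInter.1 hp n) fun t ht => lt_trans ht hn

end LiYorkePairs

section Hyperspace

theorem coe_inducedMap_iterate {X : Type*} [MetricSpace X] (f : C(X, X)) (n : ℕ)
    (K : NonemptyCompacts X) : ((inducedMap f)^[n] K : Set X) = f^[n] '' K := by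
  induction n with
  | zero => simp only [Function.iterate_zero, id, image_id]
  | succ n ih =>
    rw [Function.iterate_succ_apply', Function.iterate_succ', image_comp, ← ih]
    rfl

theorem dist_inducedMap_iterate {X : Type*} [MetricSpace X] (f : C(X, X)) (n : ℕ)
    (K L : NonemptyCompacts X) : dist ((inducedMap f)^[n] K) ((inducedMap f)^[n] L) =
      Metric.hausdorffDist (f^[n] '' K) (f^[n] '' L) := by
  rw [Metric.NonemptyCompacts.dist_eq, coe_inducedMap_iterate, coe_inducedMap_iterate]

/-- The compact sets that lie in the union of the finite family `F` and meet each of its members: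
a basic set of the Vietoris topology if the members are open, used here for intervals. -/
def vietorisSet {X : Type*} [TopologicalSpace X] (F : Finset (Set X)) : Set (NonemptyCompacts X) :=
  {K | ↑K ⊆ ⋃₀ (F : Set (Set X)) ∧ ∀ J ∈ F, (↑K ∩ J).Nonempty}

variable {X : Type*} [TopologicalSpace X] {F : Finset (Set X)}

theorem exists_mem_vietorisSet_eq_image (hF : F.Nonempty) {x : Set X → X}
    (hx : ∀ J ∈ F, x J ∈ J) : ∃ K ∈ vietorisSet F, (K : Set X) = x '' F := by
  refine ⟨⟨⟨x '' F, (F.finite_toSet.image x).isCompact⟩, (Finset.coe_nonempty.2 hF).image x⟩,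
    ⟨?_, fun J hJ => ⟨x J, mem_image_of_mem x hJ, hx J hJ⟩⟩, rfl⟩
  rintro _ ⟨J, hJ, rfl⟩
  exact ⟨J, hJ, hx J hJ⟩

theorem sup_singleton_mem_vietorisSet {K : NonemptyCompacts X} (hK : K ∈ vietorisSet F)
    {J : Set X} (hJ : J ∈ F) {z : X} (hz : z ∈ J) : K ⊔ {z} ∈ vietorisSet F := by
  simp only [vietorisSet, mem_ofPred_eq, NonemptyCompacts.coe_sup, NonemptyCompacts.coe_singleton,
    union_subset_iff, singleton_subset_iff]
  exact ⟨⟨hK.1, J, hJ, hz⟩, fun L hL => (hK.2 L hL).mono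
    (inter_subset_inter_left _ subset_union_left)⟩

variable {α : Type*} [ConditionallyCompleteLinearOrder α] [DenselyOrdered α]

theorem exists_vietorisSet_subset [Nontrivial α] [TopologicalSpace α] [OrderTopology α]
    {V : Set (NonemptyCompacts α)} (hV : IsOpen V) {K : NonemptyCompacts α} (hK : K ∈ V) :
    ∃ F : Finset (Set α), F.Nonempty ∧ (∀ J ∈ F, IsNondegInterval J) ∧ vietorisSet F ⊆ V := by
  classical
  obtain ⟨_, ⟨u, ⟨huf, hune, huo⟩, rfl⟩, hKu, huV⟩ :=
    NonemptyCompacts.isTopologicalBasis.exists_subset_of_mem_open hK hV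
  have hint : ∀ U ∈ u, ∃ J ⊆ U, IsNondegInterval J := fun U hU =>
    exists_isNondegInterval_subset (huo U hU) ((hKu.2 U hU).mono inter_subset_right)
  choose! A hAU hA using hint
  lift u to Finset (Set α) using huf
  simp only [Finset.coe_nonempty, Finset.mem_coe] at *
  refine ⟨u.image A, hune.image A, Finset.forall_mem_image.2 hA, fun L hL => huV ⟨?_, ?_⟩⟩
  · refine hL.1.trans (sUnion_subset fun J hJ => ?_)
    obtain ⟨U, hU, rfl⟩ := Finset.mem_image.1 (Finset.mem_coe.1 hJ)
    exact (hAU U hU).trans (subset_sUnion_of_mem hU)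
  · exact fun U hU => (hL.2 (A U) (Finset.mem_image_of_mem A hU)).mono
      (inter_subset_inter_right _ (hAU U hU))

theorem exists_vietorisSet_prod_subset [Nontrivial α] [TopologicalSpace α] [OrderTopology α]
    {V : Set (NonemptyCompacts α × NonemptyCompacts α)} (hV : IsOpen V) (hne : V.Nonempty) :
    ∃ F G : Finset (Set α), F.Nonempty ∧ G.Nonempty ∧ (∀ J ∈ F, IsNondegInterval J) ∧
      (∀ J ∈ G, IsNondegInterval J) ∧ vietorisSet F ×ˢ vietorisSet G ⊆ V := by
  obtain ⟨⟨K, L⟩, hKL⟩ := hne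
  obtain ⟨V₁, V₂, hV₁, hV₂, hK, hL, hsub⟩ := isOpen_prod_iff.1 hV K L hKL
  obtain ⟨F, hFne, hF, hFV⟩ := exists_vietorisSet_subset hV₁ hK
  obtain ⟨G, hGne, hG, hGV⟩ := exists_vietorisSet_subset hV₂ hL
  exact ⟨F, G, hFne, hGne, hF, hG, (prod_mono hFV hGV).trans hsub⟩

variable [MetricSpace α] [OrderTopology α] [HasMonotoneDist α] [CompactSpace α] {f : C(α, α)}
  {ε δ : ℝ} {F G : Finset (Set α)}

theorem frequently_exists_mem_vietorisSet_dist_lt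
    (hasymp : ∀ J K, IsNondegInterval J → IsNondegInterval K → AsymptoticSets f J K)
    (hFne : F.Nonempty) (hGne : G.Nonempty) (hF : ∀ J ∈ F, IsNondegInterval J)
    (hG : ∀ J ∈ G, IsNondegInterval J) (hδ : 0 < δ) :
    ∃ᶠ t in atTop, ∃ p ∈ vietorisSet F ×ˢ vietorisSet G,
      dist ((inducedMap f)^[t] p.1) ((inducedMap f)^[t] p.2) < δ := by
  classical
  have hFG : ∀ J ∈ F ∪ G, IsNondegInterval J := by
    simpa only [Finset.forall_mem_union] using And.intro hF hG
  refine (eventually_forall_exists_dist_lt_of_asymptoticSets (A := id) hasymp hFG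
    (show 0 < δ / 3 by positivity)).frequently.mono fun t ht => ?_
  obtain ⟨q, hq⟩ := exists_forall_exists_dist_lt (hFne.mono Finset.subset_union_left)
    (fun J hJ => ordConnected_image_of_continuous (f.continuous.iterate t) (hFG J hJ).ordConnected)
    ht
  simp only [exists_mem_image] at hq
  have : Nonempty α := ⟨q⟩
  choose! x hx hxq using hq
  obtain ⟨K, hK, hKx⟩ := exists_mem_vietorisSet_eq_image hFne
    fun J hJ => hx J (Finset.mem_union_left _ hJ)
  obtain ⟨L, hL, hLx⟩ := exists_mem_vietorisSet_eq_image hGne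
    fun J hJ => hx J (Finset.mem_union_right _ hJ)
  refine ⟨(K, L), ⟨hK, hL⟩, ?_⟩
  have hball : f^[t] '' K ∪ f^[t] '' L ⊆ Metric.ball q (δ / 3) := by
    rw [hKx, hLx, ← image_union, ← image_union, ← Finset.coe_union]
    rintro _ ⟨_, ⟨J, hJ, rfl⟩, rfl⟩
    exact hxq J hJ
  calc dist ((inducedMap f)^[t] K) ((inducedMap f)^[t] L)
      = Metric.hausdorffDist (f^[t] '' K) (f^[t] '' L) := dist_inducedMap_iterate f t K L
    _ ≤ Metric.diam (f^[t] '' K ∪ f^[t] '' L) :=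
      Metric.hausdorffDist_le_diam (K.nonempty.image _) (Bornology.IsBounded.all _)
        (L.nonempty.image _) (Bornology.IsBounded.all _)
    _ ≤ Metric.diam (Metric.ball q (δ / 3)) := Metric.diam_mono hball (Bornology.IsBounded.all _)
    _ ≤ 2 * (δ / 3) := Metric.diam_ball (by positivity)
    _ < δ := by linarith

theorem frequently_exists_mem_vietorisSet_lt_dist (hε : 0 < ε)
    (hspread : ∀ J, IsNondegInterval J → SpreadsBeyond f ε J)
    (hasymp : ∀ J K, IsNondegInterval J → IsNondegInterval K → AsymptoticSets f J K)
    (hFne : F.Nonempty) (hGne : G.Nonempty) (hF : ∀ J ∈ F, IsNondegInterval J)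
    (hG : ∀ J ∈ G, IsNondegInterval J) :
    ∃ᶠ t in atTop, ∃ p ∈ vietorisSet F ×ˢ vietorisSet G,
      ε < dist ((inducedMap f)^[t] p.1) ((inducedMap f)^[t] p.2) := by
  obtain ⟨U, hU⟩ := id hFne
  refine (frequently_exists_forall_exists_lt_dist (A := id) f.continuous hε hspread hasymp
    (hF U hU) hG).mono ?_
  rintro t ⟨_, ⟨z, hz, rfl⟩, ht⟩
  simp only [exists_mem_image, id] at ht
  have : Nonempty α := ⟨z⟩
  choose! y hy hzy using ht
  obtain ⟨L, hL, hLy⟩ := exists_mem_vietorisSet_eq_image hGne hy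
  have hnonempty : ∀ J ∈ F, ∃ x, x ∈ J := fun J hJ => (hF J hJ).nontrivial.nonempty
  choose! x hx using hnonempty
  obtain ⟨K, hK, -⟩ := exists_mem_vietorisSet_eq_image hFne hx
  refine ⟨(K ⊔ {z}, L), ⟨sup_singleton_mem_vietorisSet hK hU hz, hL⟩, ?_⟩
  have hzmem : f^[t] z ∈ f^[t] '' (K ⊔ {z} : NonemptyCompacts α) := mem_image_of_mem _ (by simp)
  obtain ⟨_, ⟨w, hw, rfl⟩, hwz⟩ :=
    (L.isCompact.image (f.continuous.iterate t)).exists_infDist_eq_dist (L.nonempty.image _)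
      (f^[t] z)
  rw [hLy] at hw
  obtain ⟨J, hJ, rfl⟩ := hw
  calc ε < dist (f^[t] z) (f^[t] (y J)) := hzy J hJ
    _ = Metric.infDist (f^[t] z) (f^[t] '' L) := hwz.symm
    _ ≤ Metric.hausdorffDist (f^[t] '' (K ⊔ {z} : NonemptyCompacts α)) (f^[t] '' L) :=
      Metric.infDist_le_hausdorffDist_of_mem hzmem
        (Metric.hausdorffEDist_ne_top_of_nonempty_of_bounded ⟨_, hzmem⟩ (L.nonempty.image _)
          (Bornology.IsBounded.all _) (Bornology.IsBounded.all _))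
    _ = dist ((inducedMap f)^[t] (K ⊔ {z})) ((inducedMap f)^[t] L) :=
      (dist_inducedMap_iterate f t _ _).symm

theorem genericallyEpsChaotic_inducedMap [Nontrivial α] (hε : 0 < ε)
    (hspread : ∀ J, IsNondegInterval J → ∃ ε' > ε, SpreadsBeyond f ε' J)
    (hprox : ∀ J K, IsNondegInterval J → IsNondegInterval K → ProximalSets f J K) :
    GenericallyEpsChaotic (inducedMap f) ε := by
  obtain ⟨ε', hε', hspread'⟩ := exists_uniform_spreadsBeyond f.continuous hε hspread
  have hε'0 : 0 < ε' := hε.trans hε'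
  have hasymp : ∀ J K, IsNondegInterval J → IsNondegInterval K → AsymptoticSets f J K :=
    fun _ _ hJ hK => asymptoticSets_of_spreadsBeyond_of_proximalSets f.continuous hε'0 hspread'
      hprox hJ hK
  refine genericallyEpsChaotic_of_forall_isOpen hε' (fun δ hδ V hV hne => ?_) fun V hV hne => ?_
  · obtain ⟨F, G, hFne, hGne, hF, hG, hsub⟩ := exists_vietorisSet_prod_subset hV hne
    exact (frequently_exists_mem_vietorisSet_dist_lt hasymp hFne hGne hF hG hδ).mono
      fun t ⟨p, hp, hdist⟩ => ⟨p, hsub hp, hdist⟩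
  · obtain ⟨F, G, hFne, hGne, hF, hG, hsub⟩ := exists_vietorisSet_prod_subset hV hne
    exact (frequently_exists_mem_vietorisSet_lt_dist hε'0 hspread' hasymp hFne hGne hF hG).mono
      fun t ⟨p, hp, hdist⟩ => ⟨p, hsub hp, hdist⟩

end Hyperspace

section SetModels

/-- The points with a neighbourhood on which the iterates of `f` are eventually within `δ` of `x₀`,
simultaneously for all points of the neighbourhood. -/
def uniformlyAttracted {X : Type*} [PseudoMetricSpace X] (f : X → X) (x₀ : X) (δ : ℝ) : Set X :=
  {x | ∃ V ∈ 𝓝 x, ∀ᶠ t in atTop, ∀ y ∈ V, dist (f^[t] y) x₀ ≤ δ}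

theorem isOpen_uniformlyAttracted {X : Type*} [PseudoMetricSpace X] {f : X → X} {x₀ : X} {δ : ℝ} :
    IsOpen (uniformlyAttracted f x₀ δ) :=
  isOpen_iff_mem_nhds.2 fun _ ⟨V, hV, h⟩ =>
    (eventually_mem_nhds_iff.2 hV).mono fun _ hy => ⟨V, hy, h⟩

theorem eventually_forall_dist_le_of_subset_uniformlyAttracted {X : Type*} [PseudoMetricSpace X]
    {f : X → X} {x₀ : X} {δ : ℝ} {K : Set X} (hK : IsCompact K)
    (hKsub : K ⊆ uniformlyAttracted f x₀ δ) : ∀ᶠ t in atTop, ∀ y ∈ K, dist (f^[t] y) x₀ ≤ δ := by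
  refine hK.induction_on (p := fun s => ∀ᶠ t in atTop, ∀ y ∈ s, dist (f^[t] y) x₀ ≤ δ)
    (by simp) (fun s t hst ht => ht.mono fun n hn y hy => hn y (hst hy))
    (fun s t hs ht => (hs.and ht).mono fun n hn y hy => hy.elim (hn.1 y) (hn.2 y)) fun x hx => ?_
  obtain ⟨V, hV, h⟩ := hKsub hx
  exact ⟨V, mem_nhdsWithin_of_mem_nhds hV, h⟩

/-- The system `g` is modelled, through the isometry `S`, on compact subsets of the phase space of
`f`, with enough of them to see open sets. Both `f` itself (on singletons) and the map induced by
`f` on all compact sets are of this kind, so their generic chaos can be treated at once. -/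
structure IsSetModel {Y X : Type*} [MetricSpace Y] [MetricSpace X] (f : C(Y, Y)) (g : C(X, X))
    (S : X → NonemptyCompacts Y) : Prop where
  isometry : Isometry S
  semiconj : Function.Semiconj S g (inducedMap f)
  exists_subset : ∀ U : Set Y, IsOpen U → U.Nonempty → ∃ x, (S x : Set Y) ⊆ U
  dense_subsets : ∀ U : Set Y, IsOpen U → Dense U → Dense {x | (S x : Set Y) ⊆ U}

variable {Y X : Type*} [MetricSpace Y] [MetricSpace X] {f : C(Y, Y)} {g : C(X, X)}
  {S : X → NonemptyCompacts Y} {U V : Set Y}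

theorem isSetModel_singleton (f : C(Y, Y)) : IsSetModel f f fun x => {x} where
  isometry := NonemptyCompacts.isometry_singleton
  semiconj x := SetLike.coe_injective (image_singleton (f := f) (a := x)).symm
  exists_subset _ _ hne := hne.imp fun _ => singleton_subset_iff.2
  dense_subsets U _ hU := by
    simpa only [NonemptyCompacts.coe_singleton, singleton_subset_iff, ofPred_mem_eq] using hU

theorem dense_nonemptyCompacts_subset (hU : Dense U) :
    Dense {K : NonemptyCompacts Y | (K : Set Y) ⊆ U} := by
  refine NonemptyCompacts.isTopologicalBasis.dense_iff.2 ?_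
  rintro _ ⟨u, ⟨huf, hune, huo⟩, rfl⟩ ⟨K, hK⟩
  have hmeet : ∀ V ∈ u, ∃ x, x ∈ V ∩ U := fun V hV =>
    hU.inter_open_nonempty V (huo V hV) ((hK.2 V hV).mono inter_subset_right)
  have : Nonempty Y := K.nonempty.to_type
  choose! x hx using hmeet
  lift u to Finset (Set Y) using huf
  obtain ⟨L, hL, hLx⟩ := exists_mem_vietorisSet_eq_image (Finset.coe_nonempty.1 hune)
    fun V hV => (hx V hV).1
  refine ⟨L, ⟨hL.1, hL.2⟩, ?_⟩
  rw [mem_ofPred_eq, hLx]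
  exact image_subset_iff.2 fun V hV => (hx V hV).2

theorem isSetModel_id (f : C(Y, Y)) : IsSetModel f (inducedMap f) id where
  isometry := isometry_id
  semiconj := Function.Semiconj.id_left
  exists_subset _ _ hne := hne.imp' (fun x => {x}) fun _ => singleton_subset_iff.2
  dense_subsets _ _ := dense_nonemptyCompacts_subset

namespace IsSetModel

theorem dist_iterate (h : IsSetModel f g S) (n : ℕ) (x y : X) :
    dist (g^[n] x) (g^[n] y) = Metric.hausdorffDist (f^[n] '' S x) (f^[n] '' S y) := by
  rw [← h.isometry.dist_eq, (h.semiconj.iterate_right n).eq, (h.semiconj.iterate_right n).eq,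
    dist_inducedMap_iterate]

theorem isOpen_subset (h : IsSetModel f g S) (hU : IsOpen U) : IsOpen {x | (S x : Set Y) ⊆ U} :=
  (NonemptyCompacts.isOpen_subsets_of_isOpen hU).preimage h.isometry.continuous

theorem dist_iterate_le_diam (h : IsSetModel f g S) (n : ℕ) (x y : X) {B : Set Y}
    (hB : Bornology.IsBounded B) (hx : f^[n] '' S x ⊆ B) (hy : f^[n] '' S y ⊆ B) :
    dist (g^[n] x) (g^[n] y) ≤ Metric.diam B := by
  rw [h.dist_iterate]
  exact (Metric.hausdorffDist_le_diam ((S x).nonempty.image _) (hB.subset hx)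
    ((S y).nonempty.image _) (hB.subset hy)).trans (Metric.diam_mono (union_subset hx hy) hB)

variable [CompactSpace X]

theorem exists_mem_residual (h : IsSetModel f g S) {R : Set (X × X)} (hR : R ∈ residual (X × X))
    (hU : IsOpen U) (hV : IsOpen V) (hUne : U.Nonempty) (hVne : V.Nonempty) :
    ∃ p ∈ R, (S p.1 : Set Y) ⊆ U ∧ (S p.2 : Set Y) ⊆ V := by
  obtain ⟨x, hx⟩ := h.exists_subset U hU hUne
  obtain ⟨y, hy⟩ := h.exists_subset V hV hVne
  obtain ⟨p, hp, hpR⟩ := (dense_of_mem_residual hR).inter_open_nonempty _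
    ((h.isOpen_subset hU).prod (h.isOpen_subset hV)) ⟨(x, y), hx, hy⟩
  exact ⟨p, hpR, hp.1, hp.2⟩

/-- Otherwise a generic pair of compact subsets of `U` would lie in all the sets
`uniformlyAttracted f x₀ δ`, and so would converge to `x₀`. -/
theorem exists_not_subset_closure_uniformlyAttracted (h : IsSetModel f g S)
    (hg : GenericallyChaotic g) (hU : IsOpen U) (hUne : U.Nonempty) (x₀ : Y) :
    ∃ δ > 0, ¬U ⊆ closure (uniformlyAttracted f x₀ δ) := by
  by_contra! hattr
  let W : ℕ → Set Y := fun n => uniformlyAttracted f x₀ (1 / (n + 1)) ∪ (closure U)ᶜ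
  have hWopen : ∀ n, IsOpen (W n) := fun n =>
    isOpen_uniformlyAttracted.union isClosed_closure.isOpen_compl
  have hWdense : ∀ n, Dense (W n) := fun n x => by
    by_cases hx : x ∈ closure U
    · exact closure_mono subset_union_left
        (closure_minimal (hattr _ Nat.one_div_pos_of_nat) isClosed_closure hx)
    · exact subset_closure (.inr hx)
  have hWsets : ∀ n, {p : X × X | (S p.1 : Set Y) ⊆ W n ∧ (S p.2 : Set Y) ⊆ W n} ∈
      residual (X × X) := fun n =>
    residual_of_dense_open ((h.isOpen_subset (hWopen n)).prod (h.isOpen_subset (hWopen n)))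
      ((h.dense_subsets _ (hWopen n) (hWdense n)).prod (h.dense_subsets _ (hWopen n) (hWdense n)))
  obtain ⟨p, ⟨hLY, hpW⟩, hp₁, hp₂⟩ := h.exists_mem_residual
    (inter_mem hg (countable_iInter_mem.2 hWsets)) hU hU hUne hUne
  obtain ⟨ε, hε, hfreq⟩ := mem_separatedPairs_iff.1 hLY.2
  obtain ⟨n, hn⟩ := exists_nat_one_div_lt (half_pos hε)
  have hattracted : ∀ x, (S x : Set Y) ⊆ U → (S x : Set Y) ⊆ W n →
      ∀ᶠ t in atTop, f^[t] '' S x ⊆ Metric.closedBall x₀ (1 / (n + 1)) := fun x hxU hxW =>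
    (eventually_forall_dist_le_of_subset_uniformlyAttracted (S x).isCompact fun y hy =>
      (hxW hy).resolve_right fun hy' => hy' (subset_closure (hxU hy))).mono
      fun t ht => image_subset_iff.2 ht
  have hpn := mem_iInter.1 hpW n
  obtain ⟨t, hεt, ht₁, ht₂⟩ := (hfreq.and_eventually
    ((hattracted p.1 hp₁ hpn.1).and (hattracted p.2 hp₂ hpn.2))).exists
  have hdist : dist (g^[t] p.1) (g^[t] p.2) ≤ 2 * (1 / (n + 1)) :=
    (h.dist_iterate_le_diam t _ _ Metric.isBounded_closedBall ht₁ ht₂).trans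
      (Metric.diam_closedBall Nat.one_div_pos_of_nat.le)
  linarith

variable [CompactSpace Y]

theorem proximalSets (h : IsSetModel f g S) (hR : proximalPairs g ∈ residual (X × X))
    (hU : IsOpen U) (hV : IsOpen V) (hUne : U.Nonempty) (hVne : V.Nonempty) :
    ProximalSets f U V := by
  obtain ⟨p, hp, hpU, hpV⟩ := h.exists_mem_residual hR hU hV hUne hVne
  refine fun δ hδ => (mem_proximalPairs_iff.1 hp δ hδ).mono fun t ht => ?_
  rw [h.dist_iterate] at ht
  obtain ⟨x, hx⟩ := (S p.1).nonempty
  obtain ⟨_, ⟨y, hy, rfl⟩, hxy⟩ := Metric.exists_dist_lt_of_hausdorffDist_lt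
    (mem_image_of_mem f^[t] hx) ht (Metric.hausdorffEDist_ne_top_of_nonempty_of_bounded
      ((S p.1).nonempty.image _) ((S p.2).nonempty.image _)
      (Bornology.IsBounded.all _) (Bornology.IsBounded.all _))
  exact ⟨x, hpU hx, y, hpV hy, hxy⟩

theorem exists_spreadsBeyond (h : IsSetModel f g S) {ε : ℝ}
    (hR : separatedPairs g ε ∈ residual (X × X)) (hU : IsOpen U) (hUne : U.Nonempty) :
    ∃ ε' > ε, SpreadsBeyond f ε' U := by
  obtain ⟨p, hp, hp₁, hp₂⟩ := h.exists_mem_residual hR hU hU hUne hUne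
  obtain ⟨ε', hε', hfreq⟩ := mem_separatedPairs_iff.1 hp
  exact ⟨ε', hε', hfreq.mono fun t ht => ht.trans_le <|
    h.dist_iterate_le_diam t _ _ (Bornology.IsBounded.all _) (image_mono hp₁) (image_mono hp₂)⟩

end IsSetModel

end SetModels

section PeriodicPoints

theorem exists_overlap_of_frequently_mem_image_iterate {X : Type*} {f : X → X} {J : Set X} {w : X}
    (h : ∃ᶠ t in atTop, w ∈ f^[t] '' J) : ∃ t, ∃ k > 0,
      (f^[t] '' J ∩ f^[k] '' (f^[t] '' J)).Nonempty ∧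
        ∃ᶠ j in atTop, w ∈ (f^[k])^[j] '' (f^[t] '' J) := by
  obtain ⟨s, hs⟩ := h.exists
  obtain ⟨s', hss', hs'⟩ := frequently_atTop.1 h (s + 1)
  have hk : 0 < s' - s := by omega
  have hresidue : ∃ i < s' - s, ∃ᶠ j in atTop, w ∈ f^[(s' - s) * j + (i + s)] '' J := by
    by_contra! hno
    obtain ⟨N, hN⟩ := eventually_atTop.1 ((eventually_all_finite (finite_Iio _)).2 hno)
    obtain ⟨n, hn, hw⟩ := frequently_atTop.1 h ((s' - s) * N + s)
    refine hN ((n - s) / (s' - s)) ((Nat.le_div_iff_mul_le hk).2 (by rw [mul_comm]; omega))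
      ((n - s) % (s' - s)) (Nat.mod_lt _ hk) ?_
    have hdiv := Nat.mod_add_div (n - s) (s' - s)
    rwa [show (s' - s) * ((n - s) / (s' - s)) + ((n - s) % (s' - s) + s) = n by omega]
  obtain ⟨i, -, hi⟩ := hresidue
  refine ⟨i + s, s' - s, hk, ⟨f^[i] w, ?_, ?_⟩, ?_⟩
  · rw [image_iterate_add]
    exact mem_image_of_mem _ hs
  · rw [← image_iterate_add, show s' - s + (i + s) = i + s' by omega, image_iterate_add]
    exact mem_image_of_mem _ hs'
  · simpa only [← Function.iterate_mul, ← image_iterate_add] using hi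

theorem isPreconnected_iUnion_image_iterate {X : Type*} [TopologicalSpace X] {g : X → X}
    {Q : Set X} (hg : Continuous g) (hQ : IsPreconnected Q) (hne : (Q ∩ g '' Q).Nonempty) :
    IsPreconnected (⋃ j : ℕ, g^[j] '' Q) := by
  obtain ⟨x, hx, hgx⟩ := hne
  refine IsPreconnected.iUnion_of_chain (fun j => hQ.image _ (hg.iterate j).continuousOn)
    fun j => ⟨g^[j] x, mem_image_of_mem _ hx, ?_⟩
  rw [Order.succ_eq_add_one, image_iterate_add, Function.iterate_one]
  exact mem_image_of_mem _ hgx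

theorem mapsTo_iUnion_image_iterate {X : Type*} (g : X → X) (Q : Set X) :
    MapsTo g (⋃ j : ℕ, g^[j] '' Q) (⋃ j : ℕ, g^[j] '' Q) := by
  refine mapsTo_iUnion.2 fun j => ?_
  rintro _ ⟨y, hy, rfl⟩
  exact mem_iUnion.2 ⟨j + 1, y, hy, Function.iterate_succ_apply' _ _ _⟩

theorem eventually_forall_lt_iterate {α : Type*} [ConditionallyCompleteLinearOrder α]
    [TopologicalSpace α] [OrderTopology α] {g : α → α} {C Q : Set α} {b : α} (hg : Continuous g)
    (hC : C.OrdConnected) (hgC : MapsTo g C C) (hlt : ∀ x ∈ C, x < g x) (hb : b ∈ C)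
    (hQ : IsCompact Q) (hQC : Q ⊆ C) : ∀ᶠ j in atTop, ∀ x ∈ Q, b < g^[j] x := by
  have hmono : ∀ x ∈ C, Monotone fun j => g^[j] x := fun x hx => monotone_nat_of_le_succ fun j => by
    simpa only [Function.iterate_succ_apply'] using (hlt _ (hgC.iterate j hx)).le
  have hreach : ∀ x ∈ C, ∃ j, b < g^[j] x := fun x hx => by
    by_contra! hle
    have hbdd : BddAbove (range fun j => g^[j] x) := ⟨b, forall_mem_range.2 hle⟩
    have hfix : Function.IsFixedPt g (⨆ j, g^[j] x) :=
      isFixedPt_of_tendsto_iterate (tendsto_atTop_ciSup (hmono x hx) hbdd) hg.continuousAt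
    exact (hlt _ (hC.out hx hb ⟨le_ciSup hbdd 0, ciSup_le hle⟩)).ne' hfix
  refine hQ.induction_on (p := fun s => ∀ᶠ j in atTop, ∀ x ∈ s, b < g^[j] x) (by simp)
    (fun s t hst ht => ht.mono fun j hj x hx => hj x (hst hx))
    (fun s t hs ht => (hs.and ht).mono fun j hj x hx => hx.elim (hj.1 x) (hj.2 x)) fun x hx => ?_
  obtain ⟨j, hj⟩ := hreach x (hQC hx)
  refine ⟨g^[j] ⁻¹' Ioi b ∩ Q, inter_mem (mem_nhdsWithin_of_mem_nhds
    ((hg.iterate j).continuousAt.preimage_mem_nhds (Ioi_mem_nhds hj))) self_mem_nhdsWithin, ?_⟩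
  filter_upwards [eventually_ge_atTop j] with i hi y hy
  exact lt_of_lt_of_le hy.1 (hmono y (hQC hy.2) hi)

theorem exists_isFixedPt_mem_image_iterate {α : Type*} [ConditionallyCompleteLinearOrder α]
    [TopologicalSpace α] [OrderTopology α] {g : α → α} {Q : Set α} {w : α} (hg : Continuous g)
    (hQ : IsCompact Q) (hQpre : IsPreconnected Q) (hne : (Q ∩ g '' Q).Nonempty)
    (hw : ∃ᶠ j in atTop, w ∈ g^[j] '' Q) : ∃ j, ∃ p ∈ g^[j] '' Q, Function.IsFixedPt g p := by
  have hC := isPreconnected_iUnion_image_iterate hg hQpre hne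
  have hgC := mapsTo_iUnion_image_iterate g Q
  have hQC : Q ⊆ ⋃ j : ℕ, g^[j] '' Q := fun x hx => mem_iUnion.2 ⟨0, x, hx, rfl⟩
  obtain ⟨i, hi⟩ := hw.exists
  have hwC : w ∈ ⋃ j : ℕ, g^[j] '' Q := mem_iUnion.2 ⟨i, hi⟩
  by_contra! hno
  have hside : (∀ x ∈ ⋃ j : ℕ, g^[j] '' Q, x < g x) ∨ ∀ x ∈ ⋃ j : ℕ, g^[j] '' Q, g x < x := by
    by_contra! h
    obtain ⟨⟨x, hx, hgx⟩, y, hy, hgy⟩ := h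
    obtain ⟨z, hz, hgz⟩ := hC.intermediate_value₂ hx hy hg.continuousOn continuousOn_id hgx hgy
    obtain ⟨j, hj⟩ := mem_iUnion.1 hz
    exact hno j z hj hgz
  rcases hside with hup | hdown
  · obtain ⟨j, ⟨x, hx, hxw⟩, hj⟩ := (hw.and_eventually
      (eventually_forall_lt_iterate hg hC.ordConnected hgC hup hwC hQ hQC)).exists
    exact (hj x hx).ne' hxw
  · obtain ⟨j, ⟨x, hx, hxw⟩, hj⟩ := (hw.and_eventually (eventually_forall_lt_iterate (α := αᵒᵈ) hg
      hC.ordConnected.dual hgC hdown hwC hQ hQC)).exists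
    exact (hj x hx).ne' hxw

variable {α : Type*} [ConditionallyCompleteLinearOrder α] [DenselyOrdered α] [MetricSpace α]
  [OrderTopology α] [CompactSpace α] {f : α → α} {ε : ℝ} {J : Set α}

theorem exists_frequently_mem_image_iterate (hf : Continuous f) (hε : 0 < ε)
    (hJ : J.OrdConnected) (h : SpreadsBeyond f ε J) : ∃ w, ∃ᶠ t in atTop, w ∈ f^[t] '' J := by
  obtain ⟨F, hF, hFI, hFsub⟩ := exists_finite_isNondegInterval_subset α hε
  have hcontains : ∃ᶠ t in atTop, ∃ L ∈ F, L ⊆ f^[t] '' J :=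
    Frequently.mono h fun t ht => hFsub _ (ordConnected_image_of_continuous (hf.iterate t) hJ) ht
  obtain ⟨L, hL, hfreq⟩ : ∃ L ∈ F, ∃ᶠ t in atTop, L ⊆ f^[t] '' J := by
    by_contra! hno
    exact hcontains (((eventually_all_finite hF).2 hno).mono fun t ht ⟨L, hL, hsub⟩ => ht L hL hsub)
  obtain ⟨w, hw⟩ := (hFI L hL).nontrivial.nonempty
  exact ⟨w, hfreq.mono fun t ht => ht hw⟩

theorem exists_isPeriodicPt_iterate (hf : Continuous f) (hε : 0 < ε) (hJ : J.OrdConnected)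
    (hJc : IsCompact J) (h : SpreadsBeyond f ε J) :
    ∃ x ∈ J, ∃ s, ∃ k > 0, Function.IsPeriodicPt f k (f^[s] x) := by
  obtain ⟨w, hw⟩ := exists_frequently_mem_image_iterate hf hε hJ h
  obtain ⟨t, k, hk, hne, hfreq⟩ := exists_overlap_of_frequently_mem_image_iterate hw
  obtain ⟨j, p, hp, hfix⟩ := exists_isFixedPt_mem_image_iterate (hf.iterate k)
    (hJc.image (hf.iterate t)) (hJ.isPreconnected.image _ (hf.iterate t).continuousOn) hne hfreq
  rw [← Function.iterate_mul, ← image_iterate_add] at hp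
  obtain ⟨x, hx, rfl⟩ := hp
  exact ⟨x, hx, _, k, hk, hfix⟩

end PeriodicPoints

section Confinement

variable {X : Type*} [PseudoMetricSpace X] [CompactSpace X] {f : X → X} {ε : ℝ} {J : Set X}

theorem eventually_forall_dist_le_of_not_spreadsBeyond (h : ¬SpreadsBeyond f ε J) :
    ∀ᶠ t in atTop, ∀ x ∈ J, ∀ y ∈ J, dist (f^[t] x) (f^[t] y) ≤ ε := by
  filter_upwards [not_frequently.1 h] with t ht x hx y hy
  exact (Metric.dist_le_diam_of_mem (Bornology.IsBounded.all _) (mem_image_of_mem _ hx)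
    (mem_image_of_mem _ hy)).trans (not_lt.1 ht)

/-- As `J` and `f^[r] '' J` stay close for a whole period of the eventual orbit of `x`, the points
`x` and `f^[r] x` are close at all late times, because at each phase of the period they are. -/
theorem dist_iterate_add_le_of_isPeriodicPt (hf : Continuous f) (h : ¬SpreadsBeyond f ε J) {r : ℕ}
    (hprox : ProximalSets f J (f^[r] '' J)) {x : X} (hx : x ∈ J) {s k : ℕ} (hk : 0 < k)
    (hper : Function.IsPeriodicPt f k (f^[s] x)) : dist (f^[s] x) (f^[r] (f^[s] x)) ≤ 2 * ε := by
  obtain ⟨N, hN⟩ := eventually_atTop.1 (eventually_forall_dist_le_of_not_spreadsBeyond h)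
  refine le_of_forall_pos_le_add fun δ hδ => ?_
  obtain ⟨t, ht, y, hy, _, ⟨z, hz, rfl⟩, hyz⟩ := frequently_atTop.1
    (hprox.frequently_forall_le_dist_lt hf k hδ) (max N s)
  obtain ⟨i, hik, c, hic⟩ : ∃ i ≤ k, ∃ c, i + t = k * c + s := by
    refine ⟨(k * t + s - t) % k, (Nat.mod_lt _ hk).le, t - (k * t + s - t) / k, ?_⟩
    have hdiv := Nat.mod_add_div (k * t + s - t) k
    have hle := Nat.le_mul_of_pos_left t hk
    rw [Nat.mul_sub]
    omega
  have hs : f^[i + t] x = f^[s] x := by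
    rw [hic, Function.iterate_add_apply, (hper.mul_const c).eq]
  have hrs : f^[i + t + r] x = f^[r] (f^[s] x) := by
    rw [← hs, ← Function.iterate_add_apply, add_comm]
  have hclose := hyz i hik
  simp only [← Function.iterate_add_apply, ← add_assoc] at hclose
  rw [← hrs, ← hs]
  linarith [dist_triangle4 (f^[i + t] x) (f^[i + t] y) (f^[i + t + r] z) (f^[i + t + r] x),
    hN (i + t) (by omega) x hx y hy, hN (i + t + r) (by omega) z hz x hx]

theorem exists_eventually_forall_dist_le_of_isPeriodicPt (hf : Continuous f)
    (h : ¬SpreadsBeyond f ε J) (hprox : ∀ r, ProximalSets f J (f^[r] '' J)) {x : X} (hx : x ∈ J)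
    {s k : ℕ} (hk : 0 < k) (hper : Function.IsPeriodicPt f k (f^[s] x)) :
    ∃ p, ∀ᶠ t in atTop, ∀ y ∈ J, dist (f^[t] y) p ≤ 3 * ε := by
  refine ⟨f^[s] x, ?_⟩
  filter_upwards [eventually_forall_dist_le_of_not_spreadsBeyond h, eventually_ge_atTop s]
    with t ht hst y hy
  have hxs := dist_iterate_add_le_of_isPeriodicPt hf h (hprox (t - s)) hx hk hper
  rw [← Function.iterate_add_apply, Nat.sub_add_cancel hst, dist_comm] at hxs
  linarith [dist_triangle (f^[t] y) (f^[t] x) (f^[s] x), ht y hy x hx]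

end Confinement

section Trapping

/-- The points whose forward orbit stays within distance `δ` of `x₀`. -/
def trappedSet {X : Type*} [PseudoMetricSpace X] (f : X → X) (x₀ : X) (δ : ℝ) : Set X :=
  {x | ∀ t, dist (f^[t] x) x₀ ≤ δ}

/-- Every neighbourhood of `x₀` eventually contains all the images of some nondegenerate interval:
the obstruction to spreading uniformly. -/
def AttractsIntervals {α : Type*} [Preorder α] [PseudoMetricSpace α] (f : α → α) (x₀ : α) : Prop :=
  ∀ δ > 0, ∃ J, IsNondegInterval J ∧ ∀ᶠ t in atTop, ∀ x ∈ J, dist (f^[t] x) x₀ ≤ δ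

section TrappedSet

variable {X : Type*} [PseudoMetricSpace X] {f : X → X} {x₀ : X} {δ δ' : ℝ}

theorem isClosed_trappedSet (hf : Continuous f) : IsClosed (trappedSet f x₀ δ) := by
  simp only [trappedSet, ofPred_forall]
  exact isClosed_iInter fun t => isClosed_le ((hf.iterate t).dist continuous_const)
    continuous_const

theorem trappedSet_mono (h : δ ≤ δ') : trappedSet f x₀ δ ⊆ trappedSet f x₀ δ' :=
  fun _ hx t => (hx t).trans h

theorem mapsTo_iterate_trappedSet (s : ℕ) :
    MapsTo f^[s] (trappedSet f x₀ δ) (trappedSet f x₀ δ) := fun x hx t => by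
  rw [← Function.iterate_add_apply]
  exact hx _

end TrappedSet

theorem exists_forall_mem_nhdsWithin_ordConnectedComponent {α : Type*} [LinearOrder α]
    [TopologicalSpace α] [OrderTopology α] {T : ℝ → Set α} {x₀ : α} (hT : Monotone T)
    (hnontrivial : ∀ δ > 0, (ordConnectedComponent (T δ) x₀).Nontrivial) :
    ∃ δ₀ > 0, ∀ δ > 0, T δ ∈ 𝓝[ordConnectedComponent (T δ₀) x₀] x₀ := by
  have hlt : ∀ {δ δ' : ℝ} {y}, δ ≤ δ' → y ∈ ordConnectedComponent (T δ) x₀ → x₀ < y →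
      T δ' ∈ 𝓝[≥] x₀ := fun hδ hy hlt => mem_of_superset (Icc_mem_nhdsGE hlt)
    (Icc_subset_uIcc.trans (hy.trans (hT hδ)))
  have hgt : ∀ {δ δ' : ℝ} {y}, δ ≤ δ' → y ∈ ordConnectedComponent (T δ) x₀ → y < x₀ →
      T δ' ∈ 𝓝[≤] x₀ := fun hδ hy hlt => mem_of_superset (Icc_mem_nhdsLE hlt)
    (Icc_subset_uIcc'.trans (hy.trans (hT hδ)))
  by_cases hright : ∀ δ > 0, T δ ∈ 𝓝[≥] x₀
  · by_cases hleft : ∀ δ > 0, T δ ∈ 𝓝[≤] x₀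
    · refine ⟨1, one_pos, fun δ hδ => mem_nhdsWithin_of_mem_nhds ?_⟩
      rw [← nhdsLE_sup_nhdsGE]
      exact ⟨hleft δ hδ, hright δ hδ⟩
    · push Not at hleft
      obtain ⟨δ₀, hδ₀, hno⟩ := hleft
      exact ⟨δ₀, hδ₀, fun δ hδ => nhdsWithin_mono x₀ (fun y hy => not_lt.1 fun hyx =>
        hno (hgt le_rfl hy hyx)) (hright δ hδ)⟩
  · push Not at hright
    obtain ⟨δ₀, hδ₀, hno⟩ := hright
    have hle : ∀ y ∈ ordConnectedComponent (T δ₀) x₀, y ≤ x₀ := fun y hy =>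
      not_lt.1 fun hyx => hno (hlt le_rfl hy hyx)
    refine ⟨δ₀, hδ₀, fun δ hδ => nhdsWithin_mono x₀ hle ?_⟩
    obtain ⟨y, hy, hne⟩ := (hnontrivial _ (lt_min hδ hδ₀)).exists_ne x₀
    exact hgt (min_le_left δ δ₀) hy
      ((hle y (hy.trans (hT (min_le_right δ δ₀)))).lt_of_ne hne)

theorem exists_attractsIntervals {α : Type*} [Preorder α] [PseudoMetricSpace α] [CompactSpace α]
    {f : α → α} (h : ∀ ε > 0, ∃ J, IsNondegInterval J ∧
      ∃ p, ∀ᶠ t in atTop, ∀ x ∈ J, dist (f^[t] x) p ≤ ε) : ∃ x₀, AttractsIntervals f x₀ := by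
  choose J hJ p hp using fun n : ℕ => h (1 / ((n : ℝ) + 1)) Nat.one_div_pos_of_nat
  obtain ⟨x₀, φ, hφ, hlim⟩ := CompactSpace.tendsto_subseq p
  refine ⟨x₀, fun δ hδ => ?_⟩
  obtain ⟨n, hn, hnp⟩ := (((tendsto_one_div_add_atTop_nhds_zero_nat (𝕜 := ℝ)).comp
    hφ.tendsto_atTop).eventually_lt_const (half_pos hδ) |>.and
      (Metric.tendsto_nhds.1 hlim _ (half_pos hδ))).exists
  refine ⟨J (φ n), hJ _, (hp (φ n)).mono fun t ht x hx => ?_⟩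
  have := dist_triangle (f^[t] x) (p (φ n)) x₀
  simp only [Function.comp_apply] at hn hnp
  linarith [ht x hx]

theorem AttractsIntervals.frequently_exists_dist_lt {α : Type*} [Preorder α] [PseudoMetricSpace α]
    {f : α → α} {x₀ : α} (h : AttractsIntervals f x₀)
    (hprox : ∀ J K, IsNondegInterval J → IsNondegInterval K → ProximalSets f J K) {K : Set α}
    (hK : IsNondegInterval K) {η : ℝ} (hη : 0 < η) :
    ∃ᶠ t in atTop, ∃ x ∈ K, dist (f^[t] x) x₀ < η := by
  obtain ⟨J, hJ, hJx₀⟩ := h (η / 2) (half_pos hη)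
  refine ((hprox K J hK hJ _ (half_pos hη)).and_eventually hJx₀).mono ?_
  rintro t ⟨⟨x, hx, y, hy, hxy⟩, ht⟩
  exact ⟨x, hx, by linarith [dist_triangle (f^[t] x) (f^[t] y) x₀, ht y hy]⟩

variable {α : Type*} [ConditionallyCompleteLinearOrder α] [DenselyOrdered α] [MetricSpace α]
  [OrderTopology α] {f : α → α} {x₀ : α}

theorem exists_finite_isPreconnected_cover_image_iterate [CompactSpace α] {ε : ℝ} {J : Set α}
    (hf : Continuous f) (hε : 0 < ε) (hJ : J.OrdConnected) (h : SpreadsBeyond f ε J) (N : ℕ) :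
    ∃ 𝒞 : Set (Set α), 𝒞.Finite ∧
      (∀ C ∈ 𝒞, IsPreconnected C ∧ C.Nontrivial ∧ C ⊆ ⋃ t ≥ N, f^[t] '' J) ∧
      ∀ᶠ t in atTop, f^[t] '' J ⊆ ⋃₀ 𝒞 := by
  obtain ⟨w, hw⟩ := exists_frequently_mem_image_iterate hf hε hJ h
  obtain ⟨s, k, hk, ⟨q, hq, hqk⟩, -⟩ := exists_overlap_of_frequently_mem_image_iterate hw
  -- as `f^[s] '' J` meets `f^[k + s] '' J`, the images in one residue class mod `k` chain up
  let C : ℕ → Set α := fun i => ⋃ j : ℕ, (f^[k])^[j] '' (f^[N + s + i] '' J)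
  have hCpre : ∀ i, IsPreconnected (C i) := fun i => by
    refine isPreconnected_iUnion_image_iterate (hf.iterate k)
      (hJ.isPreconnected.image _ (hf.iterate _).continuousOn) ⟨f^[i + N] q, ?_, ?_⟩
    · rw [show N + s + i = i + N + s by omega, image_iterate_add]
      exact mem_image_of_mem _ hq
    · rw [← image_iterate_add, show k + (N + s + i) = i + N + (k + s) by omega, image_iterate_add,
        image_iterate_add f k]
      exact mem_image_of_mem _ hqk
  refine ⟨C '' Iio k, (finite_Iio k).image C, forall_mem_image.2 fun i _ => ⟨hCpre i, ?_, ?_⟩, ?_⟩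
  · exact (h.nontrivial_image_iterate hε.le (N + s + i)).mono fun x hx =>
      mem_iUnion.2 ⟨0, x, hx, rfl⟩
  · refine iUnion_subset fun j => ?_
    rw [← Function.iterate_mul, ← image_iterate_add]
    exact subset_biUnion_of_mem (u := fun t => f^[t] '' J)
      (show N ≤ k * j + (N + s + i) by omega)
  · filter_upwards [eventually_ge_atTop (N + s)] with t ht
    refine subset_sUnion_of_subset _ _ ?_
      (mem_image_of_mem C (show (t - (N + s)) % k ∈ Iio k from Nat.mod_lt _ hk))
    refine subset_iUnion_of_subset ((t - (N + s)) / k) ?_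
    rw [← Function.iterate_mul, ← image_iterate_add, show k * ((t - (N + s)) / k) +
      (N + s + (t - (N + s)) % k) = t by have := Nat.mod_add_div (t - (N + s)) k; omega]

theorem AttractsIntervals.nontrivial_ordConnectedComponent [CompactSpace α]
    (h : AttractsIntervals f x₀) (hf : Continuous f)
    (hspread : ∀ J, IsNondegInterval J → ∃ ε > 0, SpreadsBeyond f ε J)
    (hprox : ∀ J K, IsNondegInterval J → IsNondegInterval K → ProximalSets f J K) {δ : ℝ}
    (hδ : 0 < δ) : (ordConnectedComponent (trappedSet f x₀ δ) x₀).Nontrivial := by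
  obtain ⟨J, hJ, hJx₀⟩ := h δ hδ
  obtain ⟨N, hN⟩ := eventually_atTop.1 hJx₀
  obtain ⟨ε, hε, hJε⟩ := hspread J hJ
  obtain ⟨𝒞, hfin, h𝒞, hcover⟩ :=
    exists_finite_isPreconnected_cover_image_iterate hf hε hJ.ordConnected hJε N
  have htail : ⋃ t ≥ N, f^[t] '' J ⊆ trappedSet f x₀ δ := by
    refine iUnion₂_subset fun n hn => ?_
    rintro _ ⟨x, hx, rfl⟩ t
    rw [← Function.iterate_add_apply]
    exact hN _ (by omega) x hx
  -- the late images of `J` accumulate at `x₀`, hence so does one of the finitely many `C ∈ 𝒞`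
  have hx₀ : x₀ ∈ closure (⋃₀ 𝒞) := Metric.mem_closure_iff.2 fun η hη => by
    obtain ⟨t, ⟨x, hx, hxη⟩, ht⟩ :=
      ((h.frequently_exists_dist_lt hprox hJ hη).and_eventually hcover).exists
    exact ⟨f^[t] x, ht (mem_image_of_mem _ hx), by rwa [dist_comm]⟩
  rw [hfin.closure_sUnion, mem_iUnion₂] at hx₀
  obtain ⟨C, hC, hx₀C⟩ := hx₀
  obtain ⟨hpre, hnontrivial, hsub⟩ := h𝒞 C hC
  have : (closure C).OrdConnected := hpre.closure.ordConnected
  exact (hnontrivial.mono subset_closure).mono (subset_ordConnectedComponent hx₀C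
    (closure_minimal (hsub.trans htail) (isClosed_trappedSet hf)))

theorem mapsTo_iterate_ordConnectedComponent_trappedSet (hf : Continuous f) {δ : ℝ}
    (hx₀ : Function.IsFixedPt f x₀) (t : ℕ) :
    MapsTo f^[t] (ordConnectedComponent (trappedSet f x₀ δ) x₀)
      (ordConnectedComponent (trappedSet f x₀ δ) x₀) := by
  intro y hy
  have hx₀mem := nonempty_ordConnectedComponent.1 ⟨y, hy⟩
  have : (f^[t] '' ordConnectedComponent (trappedSet f x₀ δ) x₀).OrdConnected :=
    ordConnected_image_of_continuous (hf.iterate t) inferInstance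
  have hsub : f^[t] '' ordConnectedComponent (trappedSet f x₀ δ) x₀ ⊆ trappedSet f x₀ δ :=
    ((mapsTo_iterate_trappedSet t).mono_left ordConnectedComponent_subset).image_subset
  have hx₀t : x₀ ∈ f^[t] '' ordConnectedComponent (trappedSet f x₀ δ) x₀ :=
    ⟨x₀, self_mem_ordConnectedComponent.2 hx₀mem, hx₀.iterate t⟩
  exact subset_ordConnectedComponent hx₀t hsub (mem_image_of_mem _ hy)

/-- The component of `x₀` in a small trapped set is an invariant interval on which `x₀` is stable;
as its subintervals all come close to `x₀`, a dense open subset of it is uniformly attracted. -/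
theorem AttractsIntervals.exists_subset_closure_uniformlyAttracted [CompactSpace α]
    (h : AttractsIntervals f x₀) (hf : Continuous f)
    (hspread : ∀ J, IsNondegInterval J → ∃ ε > 0, SpreadsBeyond f ε J)
    (hprox : ∀ J K, IsNondegInterval J → IsNondegInterval K → ProximalSets f J K) :
    ∃ U : Set α, IsOpen U ∧ U.Nonempty ∧ ∀ δ > 0, U ⊆ closure (uniformlyAttracted f x₀ δ) := by
  have hnontrivial : ∀ δ > 0, (ordConnectedComponent (trappedSet f x₀ δ) x₀).Nontrivial :=
    fun δ hδ => h.nontrivial_ordConnectedComponent hf hspread hprox hδ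
  have hfix : Function.IsFixedPt f x₀ := dist_le_zero.1 <| le_of_forall_gt_imp_ge_of_dense
    fun δ hδ => nonempty_ordConnectedComponent.1 (hnontrivial δ hδ).nonempty 1
  obtain ⟨δ₀, hδ₀, hstable⟩ := exists_forall_mem_nhdsWithin_ordConnectedComponent
    (T := trappedSet f x₀) (fun _ _ => trappedSet_mono) hnontrivial
  set P := ordConnectedComponent (trappedSet f x₀ δ₀) x₀
  have hP : IsNondegInterval P := ⟨inferInstance, hnontrivial δ₀ hδ₀⟩
  refine ⟨interior P, isOpen_interior, hP.interior_nonempty, fun δ hδ u hu =>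
    mem_closure_iff_nhds.2 fun V hV => ?_⟩
  obtain ⟨K, hKsub, hK⟩ := hP.exists_subset_inter_nhds (interior_subset hu)
    (inter_mem hV (isOpen_interior.mem_nhds hu))
  obtain ⟨η, hη, hball⟩ := Metric.mem_nhdsWithin_iff.1 (hstable δ hδ)
  obtain ⟨t, x, hxK, hxη⟩ := (h.frequently_exists_dist_lt hprox hK hη).exists
  obtain ⟨-, hxV, hxP⟩ := hKsub hxK
  refine ⟨x, hxV, _, inter_mem (isOpen_interior.mem_nhds hxP)
    ((hf.iterate t).continuousAt (Metric.isOpen_ball.mem_nhds hxη)), ?_⟩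
  filter_upwards [eventually_ge_atTop t] with r hr y hy
  have htrapped : f^[t] y ∈ trappedSet f x₀ δ := hball ⟨hy.2,
    mapsTo_iterate_ordConnectedComponent_trappedSet hf hfix t (interior_subset hy.1)⟩
  simpa only [← Function.iterate_add_apply, Nat.sub_add_cancel hr] using htrapped (r - t)

theorem exists_forall_spreadsBeyond [CompactSpace α] (hf : Continuous f)
    (hspread : ∀ J, IsNondegInterval J → ∃ ε > 0, SpreadsBeyond f ε J)
    (hprox : ∀ J K, IsNondegInterval J → IsNondegInterval K → ProximalSets f J K)
    (hattr : ∀ x₀ U, IsOpen U → U.Nonempty → ∃ δ > 0, ¬U ⊆ closure (uniformlyAttracted f x₀ δ)) :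
    ∃ ε > 0, ∀ J, IsNondegInterval J → SpreadsBeyond f ε J := by
  by_contra! hno
  have hsmall : ∀ ε > 0, ∃ J, IsNondegInterval J ∧
      ∃ p, ∀ᶠ t in atTop, ∀ x ∈ J, dist (f^[t] x) p ≤ ε := fun ε hε => by
    obtain ⟨J, hJ, hJε⟩ := hno (ε / 3) (by positivity)
    obtain ⟨a, ha, b, hb, hab⟩ := hJ.nontrivial.exists_lt
    have hI : IsNondegInterval (Icc a b) := isNondegInterval_Icc hab
    obtain ⟨e, he, hIe⟩ := hspread _ hI
    obtain ⟨x, hx, s, k, hk, hper⟩ :=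
      exists_isPeriodicPt_iterate hf he hI.ordConnected isCompact_Icc hIe
    obtain ⟨p, hp⟩ := exists_eventually_forall_dist_le_of_isPeriodicPt hf
      (fun hs => hJε (hs.mono le_rfl (hJ.ordConnected.out ha hb)))
      (fun r => hprox _ _ hI (hI.image_iterate hf hIe he.le r)) hx hk hper
    exact ⟨Icc a b, hI, p, by simpa only [mul_div_cancel₀ ε three_ne_zero] using hp⟩
  obtain ⟨x₀, hx₀⟩ := exists_attractsIntervals hsmall
  obtain ⟨U, hU, hUne, hUsub⟩ := hx₀.exists_subset_closure_uniformlyAttracted hf hspread hprox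
  obtain ⟨δ, hδ, hnot⟩ := hattr x₀ U hU hUne
  exact hnot (hUsub δ hδ)

end Trapping

section Main

variable {α : Type*} [ConditionallyCompleteLinearOrder α] [DenselyOrdered α] [MetricSpace α]
  [OrderTopology α] [CompactSpace α] {X : Type*} [MetricSpace X] [CompactSpace X]
  {f : C(α, α)} {g : C(X, X)} {S : X → NonemptyCompacts α} {J K : Set α}

theorem IsSetModel.proximalSets_of_isNondegInterval (h : IsSetModel f g S)
    (hR : proximalPairs g ∈ residual (X × X)) (hJ : IsNondegInterval J) (hK : IsNondegInterval K) :
    ProximalSets f J K :=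
  (h.proximalSets hR isOpen_interior isOpen_interior hJ.interior_nonempty
    hK.interior_nonempty).mono interior_subset interior_subset

theorem IsSetModel.exists_spreadsBeyond_of_isNondegInterval (h : IsSetModel f g S) {ε : ℝ}
    (hR : separatedPairs g ε ∈ residual (X × X)) (hJ : IsNondegInterval J) :
    ∃ ε' > ε, SpreadsBeyond f ε' J := by
  obtain ⟨ε', hε', hspread⟩ := h.exists_spreadsBeyond hR isOpen_interior hJ.interior_nonempty
  exact ⟨ε', hε', hspread.mono le_rfl interior_subset⟩

variable [HasMonotoneDist α] [Nontrivial α]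

theorem IsSetModel.genericallyEpsChaotic (h : IsSetModel f g S) {ε : ℝ} (hε : 0 < ε)
    (hg : GenericallyEpsChaotic g ε) : GenericallyEpsChaotic (inducedMap f) ε :=
  genericallyEpsChaotic_inducedMap hε
    (fun _ => h.exists_spreadsBeyond_of_isNondegInterval (mem_of_superset hg inter_subset_right))
    (fun _ _ => h.proximalSets_of_isNondegInterval (mem_of_superset hg inter_subset_left))

theorem IsSetModel.exists_genericallyEpsChaotic (h : IsSetModel f g S)
    (hg : GenericallyChaotic g) : ∃ ε, 0 < ε ∧ GenericallyEpsChaotic (inducedMap f) ε := by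
  have hprox : ∀ J K, IsNondegInterval J → IsNondegInterval K → ProximalSets f J K :=
    fun _ _ => h.proximalSets_of_isNondegInterval (mem_of_superset hg inter_subset_left)
  obtain ⟨ε, hε, hspread⟩ := exists_forall_spreadsBeyond f.continuous
    (fun _ => h.exists_spreadsBeyond_of_isNondegInterval (mem_of_superset hg inter_subset_right))
    hprox fun x₀ _ hU hUne => h.exists_not_subset_closure_uniformlyAttracted hg hU hUne x₀
  exact ⟨ε / 2, half_pos hε, genericallyEpsChaotic_inducedMap (half_pos hε)
    (fun J hJ => ⟨ε, half_lt_self hε, hspread J hJ⟩) hprox⟩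

theorem corollary4p5_general (f : C(α, α)) :
    (∀ ε : ℝ, 0 < ε → GenericallyEpsChaotic f ε → GenericallyEpsChaotic (inducedMap f) ε) ∧
    (GenericallyChaotic f → GenericallyChaotic (inducedMap f)) ∧
    (GenericallyChaotic (inducedMap f) →
      ∃ ε : ℝ, 0 < ε ∧ GenericallyEpsChaotic (inducedMap f) ε) := by
  refine ⟨fun ε hε hf => (isSetModel_singleton f).genericallyEpsChaotic hε hf,
    fun hf => ?_, fun hf => (isSetModel_id f).exists_genericallyEpsChaotic hf⟩
  obtain ⟨ε, hε, hchaotic⟩ := (isSetModel_singleton f).exists_genericallyEpsChaotic hf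
  exact hchaotic.genericallyChaotic hε.le

end Main

theorem corollary4p5 (f : C(unitInterval, unitInterval)) :
    (∀ ε : ℝ, 0 < ε → GenericallyEpsChaotic f ε → GenericallyEpsChaotic (inducedMap f) ε) ∧
    (GenericallyChaotic f → GenericallyChaotic (inducedMap f)) ∧
    (GenericallyChaotic (inducedMap f) →
      ∃ ε : ℝ, 0 < ε ∧ GenericallyEpsChaotic (inducedMap f) ε) :=
  corollary4p5_general f
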